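/- Let $\Omega=\begin{pmatrix}0&1\\-1&0\end{pmatrix}$ and let $\mathcal M_1$ be the set of real symmetric $2\times2$ matrices $V$ with $V+\tfrac{i}{2}\Omega>0$ (the covariance matrices of the faithful zero-displacement single-mode Gaussian states), an open subset of the space of real symmetric $2\times 2$ matrices. For $V\in\mathcal M_1$ put $H_V=2i\Omega\,\operatorname{arccoth}(2V\,i\Omega)$ and equip $\mathcal M_1$ with the Kubo–Mori–Bogoliubov (KMB) metric $$g_V(A,B)=-\frac12\,\frac{\partial^2}{\partial s\,\partial t}\Big|_{s=t=0}\operatorname{Tr}\big(H_{V+sB}\,(V+tA)\big)\qquad(A,B\ \text{real symmetric}).$$ Let $\mathrm{Scal}(V)$ be the scalar curvature at $V$ of its Levi-Civita connection (the $g$-trace of the Ricci tensor $\mathrm{Ric}(A,B)=\operatorname{Tr}(X\mapsto R(X,A)B)$). Let $S(V)=-\operatorname{Tr}(\hat\rho(V)\ln\hat\rho(V))$ be the von Neumann entropy of the Gaussian state $\hat\rho(V)=\det(V+\tfrac i2\Omega)^{-1/2}\exp(-\tfrac12\hat x^{T}H_V\hat x)$, where $\hat x=(\hat q,\hat p)$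 are position and momentum on $L^2(\mathbb R)$, $[\hat q,\hat p]=i$. Every $V\in\mathcal M_1$ has a unique symplectic eigenvalue, i.e. a unique $\nu>0$ with $V=T(\nu I)T^{\mathsf T}$ for some real $2\times 2$ matrix $T$ with $T\Omega T^{\mathsf T}=\Omega$. This $\nu$ lies in $(1/2,\infty)$, every number in $(1/2,\infty)$ occurs (for $V=\nu I$), and $\mathrm{Scal}(V)=\mathrm{Scal}(\nu I)$ depends on $V$ only through $\nu$. Moreover: 1. $\nu\mapsto\mathrm{Scal}(\nu I)$ is strictly increasing on $(1/2,\infty)$. 2. For all $V,V'\in\mathcal M_1$: $\mathrm{Scal}(V')>\mathrm{Scal}(V)$ if and only if $S(V')>S(V)$. 3. $\mathrm{Scal}(\nu I)\to-2$ as $\nu\to\infty$, and $\mathrm{Scal}(\nu I)\to-\infty$ as $\nu\to1/2$ from above. -/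

import Mathlib

namespace KMB

/-! ### Curvature of a metric given in a global chart of a finite-dimensional space -/

section Curvature

variable {ι : Type*} [Fintype ι] [DecidableEq ι]

/-- The partial derivative `∂ᵢ f` at `x`. -/
noncomputable def partialDeriv (i : ι) (f : (ι → ℝ) → ℝ) (x : ι → ℝ) : ℝ :=
  lineDeriv ℝ f x (Pi.single i 1)

/-- Levi-Civita Christoffel symbols
`Γᵏᵢⱼ = ½ ∑ₗ gᵏˡ (∂ᵢ gⱼₗ + ∂ⱼ gᵢₗ - ∂ₗ gᵢⱼ)` of the metric `x ↦ (gᵢⱼ(x))`. -/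
noncomputable def christoffel (g : (ι → ℝ) → Matrix ι ι ℝ) (k i j : ι) (x : ι → ℝ) : ℝ :=
  (1 / 2) * ∑ l, (g x)⁻¹ k l *
    (partialDeriv i (fun y => g y j l) x + partialDeriv j (fun y => g y i l) x
      - partialDeriv l (fun y => g y i j) x)

/-- Riemann tensor `Rˡᵢⱼₖ`, with `R(∂ᵢ, ∂ⱼ)∂ₖ = ∑ₗ Rˡᵢⱼₖ ∂ₗ`:
`∂ᵢΓˡⱼₖ - ∂ⱼΓˡᵢₖ + ∑ₘ (Γˡᵢₘ Γᵐⱼₖ - Γˡⱼₘ Γᵐᵢₖ)`. -/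
noncomputable def riemann (g : (ι → ℝ) → Matrix ι ι ℝ) (l i j k : ι) (x : ι → ℝ) : ℝ :=
  partialDeriv i (christoffel g l j k) x - partialDeriv j (christoffel g l i k) x
    + ∑ m, (christoffel g l i m x * christoffel g m j k x
      - christoffel g l j m x * christoffel g m i k x)

/-- Ricci tensor: the trace of `X ↦ R(X, ∂ⱼ)∂ₖ`. -/
noncomputable def ricci (g : (ι → ℝ) → Matrix ι ι ℝ) (j k : ι) (x : ι → ℝ) : ℝ :=
  ∑ i, riemann g i i j k x

/-- Scalar curvature: the trace of the Ricci tensor with respect to the metric. -/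
noncomputable def scalarCurvature (g : (ι → ℝ) → Matrix ι ι ℝ) (x : ι → ℝ) : ℝ :=
  ∑ j, ∑ k, (g x)⁻¹ j k * ricci g j k x

end Curvature

/-! ### Single-mode covariance matrices -/

/-- The symplectic form of one mode. -/
def Omega : Matrix (Fin 2) (Fin 2) ℝ := !![0, 1; -1, 0]

/-- A real matrix regarded as a complex one. -/
def toC (A : Matrix (Fin 2) (Fin 2) ℝ) : Matrix (Fin 2) (Fin 2) ℂ :=
  A.map (fun r : ℝ => (r : ℂ))

/-- The Hermitian matrix `V + iΩ/2` of the uncertainty relation. -/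
noncomputable def uncertaintyMatrix (V : Matrix (Fin 2) (Fin 2) ℝ) :
    Matrix (Fin 2) (Fin 2) ℂ :=
  toC V + (Complex.I / 2) • toC Omega

open scoped ComplexOrder in
/-- `V` is the covariance matrix of a faithful zero-displacement single-mode Gaussian state:
real symmetric, with the uncertainty relation `V + iΩ/2 > 0` holding strictly. -/
def IsFaithfulCov (V : Matrix (Fin 2) (Fin 2) ℝ) : Prop :=
  V.IsSymm ∧ (uncertaintyMatrix V).PosDef

/-- `ν` is the symplectic eigenvalue of `V`: `V = S (ν 1) Sᵀ` with `S` symplectic and `ν > 0`. -/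
def IsSymplecticEigenvalue (V : Matrix (Fin 2) (Fin 2) ℝ) (ν : ℝ) : Prop :=
  0 < ν ∧ ∃ S : Matrix (Fin 2) (Fin 2) ℝ,
    S * Omega * S.transpose = Omega ∧
      V = S * (ν • (1 : Matrix (Fin 2) (Fin 2) ℝ)) * S.transpose

/-! ### The matrix `H_V` -/

/-- The inverse hyperbolic cotangent `½ log ((z + 1) / (z - 1))`. -/
noncomputable def arccoth (z : ℂ) : ℂ := (1 / 2) * Complex.log ((z + 1) / (z - 1))

/-- `f(M)` for a diagonalisable matrix `M`: the value at `M` of the polynomial that interpolates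
`f` on the set of eigenvalues of `M`. -/
noncomputable def matrixFunction (f : ℂ → ℂ) (M : Matrix (Fin 2) (Fin 2) ℂ) :
    Matrix (Fin 2) (Fin 2) ℂ :=
  Polynomial.aeval M (Lagrange.interpolate M.charpoly.roots.toFinset id f)

/-- `H_V = 2iΩ arccoth(2 V iΩ)`. -/
noncomputable def hamiltonianMatrix (V : Matrix (Fin 2) (Fin 2) ℝ) :
    Matrix (Fin 2) (Fin 2) ℂ :=
  ((2 * Complex.I) • toC Omega) *
    matrixFunction arccoth (((2 : ℂ) • toC V) * (Complex.I • toC Omega))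

/-! ### The KMB metric on the manifold of covariance matrices, and its scalar curvature -/

/-- The KMB metric
`g_V(A, B) = -½ ∂²/∂s∂t|_{s=t=0} Tr (H_{V+sB} (V + tA))` at `V`, on symmetric matrices `A`, `B`. -/
noncomputable def kmbMetric (V A B : Matrix (Fin 2) (Fin 2) ℝ) : ℝ :=
  -(1 / 2) * deriv (fun s : ℝ => deriv (fun t : ℝ =>
    (Matrix.trace (hamiltonianMatrix (V + s • B) * toC (V + t • A))).re) 0) 0

/-- The linear coordinates on the space of symmetric `2 × 2` matrices. -/
def symmOfCoord (x : Fin 3 → ℝ) : Matrix (Fin 2) (Fin 2) ℝ := !![x 0, x 1; x 1, x 2]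

/-- The coordinates of a symmetric `2 × 2` matrix. -/
def coord (V : Matrix (Fin 2) (Fin 2) ℝ) : Fin 3 → ℝ := ![V 0 0, V 0 1, V 1 1]

/-- The components of the KMB metric in the coordinates `symmOfCoord`. -/
noncomputable def kmbGram (x : Fin 3 → ℝ) : Matrix (Fin 3) (Fin 3) ℝ :=
  Matrix.of fun i j =>
    kmbMetric (symmOfCoord x) (symmOfCoord (Pi.single i 1)) (symmOfCoord (Pi.single j 1))

/-- The KMB scalar curvature `Scal(V)`. -/
noncomputable def scal (V : Matrix (Fin 2) (Fin 2) ℝ) : ℝ := scalarCurvature kmbGram (coord V)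

/-! ### The Gaussian state and its von Neumann entropy -/

/-- Position operator `(q̂ ψ)(x) = x ψ(x)` on Schwartz functions. -/
noncomputable def position : Module.End ℂ (SchwartzMap ℝ ℂ) :=
  (SchwartzMap.smulLeftCLM (𝕜 := ℂ) ℂ (fun x : ℝ => (x : ℂ))).toLinearMap

/-- Momentum operator `p̂ ψ = -i ψ'` on Schwartz functions. -/
noncomputable def momentum : Module.End ℂ (SchwartzMap ℝ ℂ) :=
  (-Complex.I) • (SchwartzMap.derivCLM ℂ ℂ).toLinearMap

/-- The vector of quadratures `x̂ = (q̂, p̂)`. -/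
noncomputable def quadrature : Fin 2 → Module.End ℂ (SchwartzMap ℝ ℂ) := ![position, momentum]

/-- The quadratic Hamiltonian `½ x̂ᵀ H_V x̂`. -/
noncomputable def quadraticHamiltonian (V : Matrix (Fin 2) (Fin 2) ℝ) :
    Module.End ℂ (SchwartzMap ℝ ℂ) :=
  (1 / 2 : ℂ) • ∑ j, ∑ k, hamiltonianMatrix V j k • (quadrature j * quadrature k)

/-- The Gaussian state is
`ρ(V) = det (V + iΩ/2)^{-1/2} exp (-½ x̂ᵀ H_V x̂)`; on an eigenvector of `½ x̂ᵀ H_V x̂` with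
eigenvalue `E` it acts as multiplication by this number. -/
noncomputable def stateEigenvalue (V : Matrix (Fin 2) (Fin 2) ℝ) (E : ℝ) : ℝ :=
  Real.sqrt (1 / (uncertaintyMatrix V).det.re) * Real.exp (-E)

/-- The von Neumann entropy `-Tr (ρ(V) ln ρ(V))`, the trace being taken in an eigenbasis of
`½ x̂ᵀ H_V x̂`: the sum of `-p ln p` over the eigenvalues `p` of `ρ(V)`, with multiplicity.
For a faithful `V` this Hamiltonian is a positive-definite quadratic one, so its eigenvectors are
Schwartz functions and `L²(ℝ)` has an orthonormal basis of them. -/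
noncomputable def entropy (V : Matrix (Fin 2) (Fin 2) ℝ) : ℝ :=
  ∑' E : ℝ, (Module.finrank ℂ (Module.End.eigenspace (quadraticHamiltonian V) (E : ℂ)) : ℝ) *
    Real.negMulLog (stateEigenvalue V E)

end KMB

namespace KMB

/-! ### The matrix `H_V` in closed form -/

/-! Everything is governed by `d = det V = ν²`, and then by the half inverse temperature `t` with
`tanh t = 1/(2ν)`. The matrix `2V iΩ` has opposite eigenvalues `±2ν`, and arccoth is odd there, so
`H_V` is `φ(d)` times the adjugate of `V`, where `φ` is `profile` (`hamiltonianMatrix_eq`). Pairing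
the adjugate with `A` differentiates det along `A`; hence the metric is `-½` times the Hessian of `Φ
∘ det` with `Φ' = φ` (`kmbMetric_symmOfCoord`).

Write `u` and `Q` for the gradient and Hessian of det at the coordinate vector `x`. The Gram matrix,
its inverse, the Christoffel symbols and the Ricci tensor are all combinations of `x`, `u`, `Q`,
`Q⁻¹` and the identity, with coefficients depending on `d`; the contractions `u·x = 2d`, `Qx = u`,
`Q⁻¹u = x` suffice to compute the curvature (`ricci_of_christoffel`). Since `φ` satisfies a
first-order linear equation with rational coefficients, its derivatives can be eliminated and Scal
becomes a rational function of `d` and `φ(d)` (`scal_eq`).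

Substituting `ν = ½ coth t` gives `Scal = -3/2 - curvatureProfile t` (`scal_eq_of_coordDet`), and
`strictMonoOn_curvatureProfile` makes this strictly decreasing in `t`. On the other side `½ x̂ᵀH_V
x̂` is a harmonic oscillator with simple levels `t(2n+1)`, so the entropy is the thermal expression
`t coth t - log(2 sinh t)` (`entropy_eq`), which also strictly decreases in `t`
(`strictAntiOn_entropyProfile`). Thus both quantities order states by decreasing `t`, that is, by
increasing `ν`, and the limits `ν → ∞` and `ν → 1/2` become `t → 0` and `t → ∞`. -/

/-- `2 arccoth (2ν) / ν` as a function of `d = ν²`. -/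
noncomputable def profile (d : ℝ) : ℝ :=
  Real.log ((2 * √d + 1) / (2 * √d - 1)) / √d

theorem half_lt_sqrt {d : ℝ} (hd : 1 / 4 < d) : 1 / 2 < √d := by
  apply Real.lt_sqrt_of_sq_lt
  norm_num at hd ⊢
  exact hd

theorem arccoth_two_mul {ν : ℝ} (hν : 1 / 2 < ν) :
    arccoth (2 * ν : ℂ) = ((1 / 2 * Real.log ((2 * ν + 1) / (2 * ν - 1)) : ℝ) : ℂ) := by
  have h : 0 ≤ (2 * ν + 1) / (2 * ν - 1) := div_nonneg (by linarith) (by linarith)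
  rw [arccoth, Complex.ofReal_mul, Complex.ofReal_log h]
  push_cast
  rfl

/-- Changing the sign of the argument inverts the quotient inside the logarithm. Both quotients are
positive reals, so no branch issue spoils oddness. -/
theorem arccoth_neg_two_mul {ν : ℝ} (hν : 1 / 2 < ν) :
    arccoth (-(2 * ν) : ℂ) = -((1 / 2 * Real.log ((2 * ν + 1) / (2 * ν - 1)) : ℝ) : ℂ) := by
  have h : 0 ≤ (2 * ν - 1) / (2 * ν + 1) := div_nonneg (by linarith) (by linarith)
  have e : (-(2 * ν) + 1 : ℂ) / (-(2 * ν) - 1) = (((2 * ν - 1) / (2 * ν + 1) : ℝ) : ℂ) := by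
    push_cast
    rw [← neg_div_neg_eq]
    ring
  rw [arccoth, e, ← Complex.ofReal_log h, ← inv_div (2 * ν + 1), Real.log_inv]
  push_cast
  ring

/-- On two opposite nodes an odd function is interpolated by a linear polynomial without constant
term, so the matrix function is a scalar multiple of the matrix. -/
theorem matrixFunction_of_charpoly {f : ℂ → ℂ} {M : Matrix (Fin 2) (Fin 2) ℂ} {z k : ℂ}
    (hz : z ≠ 0) (hM : M.charpoly = (Polynomial.X - Polynomial.C z) *
      (Polynomial.X - Polynomial.C (-z))) (h₁ : f z = k * z) (h₂ : f (-z) = -(k * z)) :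
    matrixFunction f M = k • M := by
  have hne : z ≠ -z := fun h => hz (self_eq_neg.mp h)
  have hr : M.charpoly.roots.toFinset = {z, -z} := by
    rw [hM, Polynomial.roots_mul (mul_ne_zero (Polynomial.X_sub_C_ne_zero _)
      (Polynomial.X_sub_C_ne_zero _)), Polynomial.roots_X_sub_C, Polynomial.roots_X_sub_C]
    ext w
    simp
  have hp : Polynomial.C k * Polynomial.X =
      Lagrange.interpolate ({z, -z} : Finset ℂ) id f := by
    refine Lagrange.eq_interpolate_of_eval_eq f (Function.injective_id.injOn) ?_ ?_
    · rw [Finset.card_pair hne]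
      exact lt_of_le_of_lt (Polynomial.degree_C_mul_X_le k) (by norm_num)
    · intro w hw
      rcases Finset.mem_insert.mp hw with rfl | hw
      · simp [h₁]
      · rw [Finset.mem_singleton.mp hw]
        simp [h₂]
  rw [matrixFunction, hr, ← hp]
  simp [Algebra.smul_def]

theorem hamiltonianMatrix_eq {a b c : ℝ} (h : 1 / 4 < a * c - b * b) :
    hamiltonianMatrix !![a, b; b, c] =
      toC (profile (a * c - b * b) • !![c, -b; -b, a]) := by
  set d := a * c - b * b with hd
  have hν := half_lt_sqrt h
  have hsq : ((√d : ℝ) : ℂ) * (√d : ℝ) = a * c - b * b := by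
    rw [← Complex.ofReal_mul, Real.mul_self_sqrt (by linarith), hd]
    push_cast
    rfl
  have hν0 : ((√d : ℝ) : ℂ) ≠ 0 := by
    exact_mod_cast (show √d ≠ 0 by linarith)
  have hI := Complex.I_mul_I
  set M := ((2 : ℂ) • toC !![a, b; b, c]) * (Complex.I • toC Omega) with hMdef
  have hM : M = !![-(2 * Complex.I * b), 2 * Complex.I * a; -(2 * Complex.I * c),
      2 * Complex.I * b] := by
    ext i j
    fin_cases i <;> fin_cases j <;>
      simp [hMdef, toC, Omega, Matrix.mul_apply, Fin.sum_univ_two] <;> ring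
  have hchar : M.charpoly = (Polynomial.X - Polynomial.C (2 * (√d : ℝ) : ℂ)) *
      (Polynomial.X - Polynomial.C (-(2 * (√d : ℝ)) : ℂ)) := by
    have ht : M.trace = 0 := by rw [hM, Matrix.trace_fin_two_of]; ring
    have hdet : M.det = -(2 * (√d : ℝ) * (2 * (√d : ℝ)) : ℂ) := by
      rw [hM, Matrix.det_fin_two_of]
      linear_combination (-4 * (b : ℂ) * b + 4 * a * c) * hI + 4 * hsq
    rw [Matrix.charpoly_fin_two, ht, hdet]
    simp only [map_neg, map_zero, map_mul]
    ring
  have hf := matrixFunction_of_charpoly (f := arccoth) (M := M) (z := (2 * (√d : ℝ) : ℂ))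
    (k := ((profile d / 4 : ℝ) : ℂ)) (mul_ne_zero two_ne_zero hν0) hchar
    (by rw [arccoth_two_mul hν, profile]; push_cast; field_simp; ring)
    (by rw [arccoth_neg_two_mul hν, profile]; push_cast; field_simp; ring)
  rw [hamiltonianMatrix, hf, hM]
  ext i j
  fin_cases i <;> fin_cases j <;>
    simp [toC, Omega, Matrix.mul_apply, Fin.sum_univ_two]
  · linear_combination (-(profile d : ℂ) * c) * hI
  · linear_combination ((profile d : ℂ) * b) * hI
  · linear_combination ((profile d : ℂ) * b) * hI
  · linear_combination (-(profile d : ℂ) * a) * hI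

/-! ### The metric in closed form -/

/-- First derivative of `profile`. -/
noncomputable def profileDeriv (d : ℝ) : ℝ := -(4 / (4 * d - 1) + profile d) / (2 * d)

theorem hasDerivAt_profile {d : ℝ} (hd : 1 / 4 < d) :
    HasDerivAt profile (profileDeriv d) d := by
  have hν := half_lt_sqrt hd
  have hd0 : d ≠ 0 := by linarith
  have h1 : 2 * √d + 1 ≠ 0 := by linarith
  have h2 : 2 * √d - 1 ≠ 0 := by linarith
  have h0 : √d ≠ 0 := by linarith
  have hs := Real.hasDerivAt_sqrt hd0
  have hn := (hs.const_mul 2).add_const 1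
  have hm := (hs.const_mul 2).sub_const 1
  have := ((hn.div hm h2).log (div_ne_zero h1 h2)).div hs h0
  refine this.congr_deriv ?_
  have e : d = √d * √d := (Real.mul_self_sqrt (by linarith)).symm
  have h3 : 4 * d - 1 = (2 * √d + 1) * (2 * √d - 1) := by linear_combination 4 * e
  rw [profileDeriv, h3, profile]
  simp only [Pi.div_apply]
  generalize Real.log ((2 * √d + 1) / (2 * √d - 1)) = L
  have e2 : √d ^ 2 = d := Real.sq_sqrt (by linarith)
  rw [← e2]
  simp only [Real.sqrt_sq (Real.sqrt_nonneg d)]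
  field_simp
  ring

/-- The determinant of the symmetric matrix with coordinates `x`. -/
def coordDet (x : Fin 3 → ℝ) : ℝ := x 0 * x 2 - x 1 * x 1

/-- The gradient of `coordDet`. -/
def coordGrad (x : Fin 3 → ℝ) : Fin 3 → ℝ := ![x 2, -2 * x 1, x 0]

/-- The Hessian of `coordDet`. -/
def coordHess : Fin 3 → Fin 3 → ℝ := ![![0, 0, 1], ![0, -2, 0], ![1, 0, 0]]

theorem kmbMetric_symmOfCoord {x : Fin 3 → ℝ} (hx : 1 / 4 < coordDet x) (y z : Fin 3 → ℝ) :
    kmbMetric (symmOfCoord x) (symmOfCoord y) (symmOfCoord z) =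
      -(1 / 2) * (profileDeriv (coordDet x) * (∑ i, coordGrad x i * z i) *
        (∑ i, coordGrad x i * y i) + profile (coordDet x) *
          ∑ i, ∑ j, coordHess i j * y i * z j) := by
  have hadd (s : ℝ) (w : Fin 3 → ℝ) : symmOfCoord x + s • symmOfCoord w =
      !![x 0 + s * w 0, x 1 + s * w 1; x 1 + s * w 1, x 2 + s * w 2] := by
    ext i j
    fin_cases i <;> fin_cases j <;> simp [symmOfCoord]
  let q : ℝ → ℝ := fun s =>
    (x 0 + s * z 0) * (x 2 + s * z 2) - (x 1 + s * z 1) * (x 1 + s * z 1)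
  have hl (i : Fin 3) : HasDerivAt (fun s : ℝ => x i + s * z i) (z i) 0 := by
    simpa using ((hasDerivAt_id (0 : ℝ)).mul_const (z i)).const_add (x i)
  have hq : HasDerivAt q (∑ i, coordGrad x i * z i) 0 := by
    refine (((hl 0).mul (hl 2)).sub ((hl 1).mul (hl 1))).congr_deriv ?_
    simp [Fin.sum_univ_three, coordGrad]
    ring
  have hq0 : q 0 = coordDet x := by simp [q, coordDet]
  -- The closed form of `H` needs determinant above `1/4`; this persists for small `s`, which is all
  -- the outer derivative sees.
  have hev : ∀ᶠ s in nhds (0 : ℝ), 1 / 4 < q s :=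
    hq.continuousAt.eventually (lt_mem_nhds (by rw [hq0]; exact hx))
  have hinner : ∀ᶠ s in nhds (0 : ℝ), deriv (fun t : ℝ => (Matrix.trace
      (hamiltonianMatrix (symmOfCoord x + s • symmOfCoord z) *
        toC (symmOfCoord x + t • symmOfCoord y))).re) 0 =
      profile (q s) * ((x 2 + s * z 2) * y 0 - 2 * (x 1 + s * z 1) * y 1
        + (x 0 + s * z 0) * y 2) := by
    filter_upwards [hev] with s hs
    have hlin : (fun t : ℝ => (Matrix.trace
      (hamiltonianMatrix (symmOfCoord x + s • symmOfCoord z) *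
        toC (symmOfCoord x + t • symmOfCoord y))).re) = fun t : ℝ =>
        profile (q s) * ((x 2 + s * z 2) * x 0 - 2 * (x 1 + s * z 1) * x 1
          + (x 0 + s * z 0) * x 2) +
        t * (profile (q s) * ((x 2 + s * z 2) * y 0 - 2 * (x 1 + s * z 1) * y 1
          + (x 0 + s * z 0) * y 2)) := by
      funext t
      rw [hadd s z, hadd t y, hamiltonianMatrix_eq hs]
      change (Matrix.trace (toC (profile (q s) • _) * _)).re = _
      simp [toC, Matrix.trace_fin_two, Matrix.mul_apply, Fin.sum_univ_two]
      ring
    rw [hlin]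
    refine HasDerivAt.deriv ?_
    simpa using ((hasDerivAt_id (0 : ℝ)).mul_const (profile (q s) *
      ((x 2 + s * z 2) * y 0 - 2 * (x 1 + s * z 1) * y 1 + (x 0 + s * z 0) * y 2))).const_add
      (profile (q s) * ((x 2 + s * z 2) * x 0 - 2 * (x 1 + s * z 1) * x 1
          + (x 0 + s * z 0) * x 2))
  have hp : HasDerivAt (fun s => profile (q s)) (profileDeriv (coordDet x) *
      ∑ i, coordGrad x i * z i) 0 :=
    HasDerivAt.comp (0 : ℝ) (h₂ := profile) (by rw [hq0]; exact hasDerivAt_profile hx) hq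
  rw [kmbMetric, Filter.EventuallyEq.deriv_eq hinner]
  congr 1
  refine (hp.mul ((((hl 2).mul_const (y 0)).sub (((hl 1).const_mul 2).mul_const (y 1))).add
    ((hl 0).mul_const (y 2)))).deriv.trans ?_
  simp [hq0, Fin.sum_univ_three, coordGrad, coordHess]
  ring

theorem kmbGram_apply {x : Fin 3 → ℝ} (hx : 1 / 4 < coordDet x) (i j : Fin 3) :
    kmbGram x i j = -(1 / 2) * (profileDeriv (coordDet x) * coordGrad x i * coordGrad x j
      + profile (coordDet x) * coordHess i j) := by
  rw [kmbGram, Matrix.of_apply, kmbMetric_symmOfCoord hx]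
  fin_cases i <;> fin_cases j <;> simp [Fin.sum_univ_three, coordHess] <;> ring

/-! ### Curvature of the metric -/

theorem profile_pos {d : ℝ} (hd : 1 / 4 < d) : 0 < profile d := by
  have hν := half_lt_sqrt hd
  refine div_pos (Real.log_pos ?_) (by linarith)
  rw [one_lt_div (by linarith)]
  linarith

theorem isOpen_coordDet : IsOpen {x : Fin 3 → ℝ | 1 / 4 < coordDet x} := by
  refine isOpen_lt continuous_const ?_
  unfold coordDet
  fun_prop

theorem hasDerivAt_line_apply (x : Fin 3 → ℝ) (i k : Fin 3) :
    HasDerivAt (fun t : ℝ => (x + t • (Pi.single i 1 : Fin 3 → ℝ)) k) (if k = i then 1 else 0) 0 := by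
  have := ((hasDerivAt_id (0 : ℝ)).mul_const (Pi.single (M := fun _ => ℝ) i (1 : ℝ) k)).const_add
    (x k)
  refine this.congr_deriv ?_
  rw [one_mul, Pi.single_apply]

theorem hasDerivAt_line_coordDet (x : Fin 3 → ℝ) (i : Fin 3) :
    HasDerivAt (fun t : ℝ => coordDet (x + t • (Pi.single i 1 : Fin 3 → ℝ))) (coordGrad x i) 0 := by
  refine (((hasDerivAt_line_apply x i 0).mul (hasDerivAt_line_apply x i 2)).sub
    ((hasDerivAt_line_apply x i 1).mul (hasDerivAt_line_apply x i 1))).congr_deriv ?_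
  fin_cases i <;> simp [coordGrad]
  ring

theorem hasDerivAt_line_coordGrad (x : Fin 3 → ℝ) (i j : Fin 3) :
    HasDerivAt (fun t : ℝ => coordGrad (x + t • (Pi.single i 1 : Fin 3 → ℝ)) j) (coordHess i j) 0 := by
  fin_cases j
  · refine (hasDerivAt_line_apply x i 2).congr_deriv ?_
    fin_cases i <;> simp [coordHess]
  · refine ((hasDerivAt_line_apply x i 1).const_mul (-2)).congr_deriv ?_
    fin_cases i <;> simp [coordHess]
  · refine (hasDerivAt_line_apply x i 0).congr_deriv ?_
    fin_cases i <;> simp [coordHess]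

theorem hasDerivAt_line_comp_coordDet {f : ℝ → ℝ} {f' : ℝ} {x : Fin 3 → ℝ}
    (hf : HasDerivAt f f' (coordDet x)) (i : Fin 3) :
    HasDerivAt (fun t : ℝ => f (coordDet (x + t • (Pi.single i 1 : Fin 3 → ℝ)))) (f' * coordGrad x i) 0 :=
  HasDerivAt.comp (0 : ℝ) (h₂ := f) (by simpa using hf) (hasDerivAt_line_coordDet x i)

/-- Closed forms hold only on the open set `det > 1/4`; a directional derivative depends on the germ
alone. -/
theorem partialDeriv_eq_of_eqOn {f h : (Fin 3 → ℝ) → ℝ} {x : Fin 3 → ℝ} {h' : ℝ} {i : Fin 3}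
    (hx : 1 / 4 < coordDet x) (hfh : ∀ y, 1 / 4 < coordDet y → f y = h y)
    (hh : HasDerivAt (fun t : ℝ => h (x + t • (Pi.single i 1 : Fin 3 → ℝ))) h' 0) :
    partialDeriv i f x = h' := by
  have hev : f =ᶠ[nhds x] h := by
    filter_upwards [isOpen_coordDet.mem_nhds hx] with y hy using hfh y hy
  rw [partialDeriv, hev.lineDeriv_eq]
  exact hh.deriv

/-- The Christoffel symbols of a metric on the cone of symmetric matrices that is
invariant under congruence by matrices of determinant one. -/
def coneChristoffel (α β γ : ℝ → ℝ) (k i j : Fin 3) (x : Fin 3 → ℝ) : ℝ :=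
  α (coordDet x) * (x k * (coordGrad x i * coordGrad x j)) +
    β (coordDet x) * (x k * coordHess i j) +
    γ (coordDet x) * ((if k = i then 1 else 0) * coordGrad x j +
      (if k = j then 1 else 0) * coordGrad x i)

/-- The contractions `u·x = 2d` and `Qx = u` leave only multiples of `u ⊗ u` and `Q`. The two
contributions of `α'` are both `2d α' u ⊗ u` and cancel, so with the KMB coefficients no third
derivative of `profile` survives. -/
theorem ricci_of_christoffel {g : (Fin 3 → ℝ) → Matrix (Fin 3) (Fin 3) ℝ} {α β γ : ℝ → ℝ}
    {α' β' γ' : ℝ} {x : Fin 3 → ℝ} (hx : 1 / 4 < coordDet x)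
    (hg : ∀ k i j y, 1 / 4 < coordDet y → christoffel g k i j y = coneChristoffel α β γ k i j y)
    (hα : HasDerivAt α α' (coordDet x)) (hβ : HasDerivAt β β' (coordDet x))
    (hγ : HasDerivAt γ γ' (coordDet x)) (j k : Fin 3) {d a b c : ℝ} (hd : coordDet x = d)
    (ha : α d = a) (hb : β d = b) (hc : γ d = c) :
    ricci g j k x =
      (3 * a - β' - 2 * γ' + 4 * d * a * c - 2 * d * a * b - b ^ 2 + 2 * c ^ 2) *
          (coordGrad x j * coordGrad x k) +
        (2 * d * β' + 2 * b - 2 * c - 2 * d * a + 4 * d ^ 2 * a * b + 2 * d * b ^ 2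
          + 4 * d * b * c) * coordHess j k := by
  have hder (m k i j : Fin 3) : partialDeriv m (christoffel g k i j) x =
      α' * coordGrad x m * (x k * (coordGrad x i * coordGrad x j)) +
        a * ((if k = m then 1 else 0) * (coordGrad x i * coordGrad x j) +
          x k * (coordHess m i * coordGrad x j + coordGrad x i * coordHess m j)) +
      (β' * coordGrad x m * (x k * coordHess i j) +
        b * ((if k = m then 1 else 0) * coordHess i j)) +
      (γ' * coordGrad x m * ((if k = i then 1 else 0) * coordGrad x j +
          (if k = j then 1 else 0) * coordGrad x i) +
        c * ((if k = i then 1 else 0) * coordHess m j +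
          (if k = j then 1 else 0) * coordHess m i)) := by
    refine partialDeriv_eq_of_eqOn hx (hg k i j) ?_
    have hu := hasDerivAt_line_coordGrad x m
    have hk := hasDerivAt_line_apply x m k
    refine ((((hasDerivAt_line_comp_coordDet hα m).mul (hk.mul ((hu i).mul (hu j)))).add
      ((hasDerivAt_line_comp_coordDet hβ m).mul (hk.mul_const (coordHess i j)))).add
      ((hasDerivAt_line_comp_coordDet hγ m).mul (((hu j).const_mul _).add
        ((hu i).const_mul _)))).congr_deriv ?_
    simp only [zero_smul, add_zero, Pi.mul_apply, Pi.add_apply, Pi.zero_apply, hd, ha, hb, hc]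
  have hΓ (k i j : Fin 3) : christoffel g k i j x = a * (x k * (coordGrad x i * coordGrad x j)) +
    b * (x k * coordHess i j) + c * ((if k = i then 1 else 0) * coordGrad x j +
      (if k = j then 1 else 0) * coordGrad x i) := by
    rw [hg k i j x hx, coneChristoffel, hd, ha, hb, hc]
  have hd' : d = x 0 * x 2 - x 1 * x 1 := hd.symm
  simp only [ricci, riemann, hder, hΓ, Fin.sum_univ_three]
  subst hd'
  fin_cases j <;> fin_cases k <;> simp [coordGrad, coordHess] <;> ring

/-! ### The differential equation of `profile` and the Levi-Civita connection -/

theorem profileDeriv_relation {d : ℝ} (hd : 1 / 4 < d) :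
    2 * d * (4 * d - 1) * profileDeriv d + (4 * d - 1) * profile d + 4 = 0 := by
  have h1 : 4 * d - 1 ≠ 0 := by linarith
  have h2 : d ≠ 0 := by linarith
  have e1 : 4 / (4 * d - 1) * (4 * d - 1) = 4 := div_mul_cancel₀ _ h1
  have e2 : 2 * d * profileDeriv d = -(4 / (4 * d - 1) + profile d) :=
    mul_div_cancel₀ _ (mul_ne_zero two_ne_zero h2)
  linear_combination (4 * d - 1) * e2 - e1

/-- Second derivative of `profile`. -/
noncomputable def profileDeriv₂ (d : ℝ) : ℝ := (16 / (4 * d - 1) ^ 2 - 3 * profileDeriv d) / (2 * d)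

/-- Third derivative of `profile`. -/
noncomputable def profileDeriv₃ (d : ℝ) : ℝ :=
  (-(128 / (4 * d - 1) ^ 3) - 5 * profileDeriv₂ d) / (2 * d)

/-- Differentiating `2d φ' = -(4/(4d-1) + φ)` gives `2d φ'' + 3φ' = 16/(4d-1)²`; one more
differentiation gives the third derivative. -/
theorem hasDerivAt_profileDeriv {d : ℝ} (hd : 1 / 4 < d) :
    HasDerivAt profileDeriv (profileDeriv₂ d) d := by
  have h1 : 4 * d - 1 ≠ 0 := by linarith
  have h2 : 2 * d ≠ 0 := by linarith
  have hl := ((hasDerivAt_id d).const_mul 4).sub_const 1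
  have := (((hl.inv h1).const_mul 4).add (hasDerivAt_profile hd)).neg.div
    ((hasDerivAt_id d).const_mul 2) h2
  refine this.congr_deriv ?_
  simp only [profileDeriv₂, Pi.neg_apply, Pi.add_apply, id, profileDeriv, Pi.inv_apply]
  field_simp
  ring

theorem hasDerivAt_profileDeriv₂ {d : ℝ} (hd : 1 / 4 < d) :
    HasDerivAt profileDeriv₂ (profileDeriv₃ d) d := by
  have h1 : 4 * d - 1 ≠ 0 := by linarith
  have h2 : 2 * d ≠ 0 := by linarith
  have hl := (((hasDerivAt_id d).const_mul 4).sub_const 1).pow 2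
  have := (((hl.inv (pow_ne_zero 2 h1)).const_mul 16).sub
    ((hasDerivAt_profileDeriv hd).const_mul 3)).div ((hasDerivAt_id d).const_mul 2) h2
  refine this.congr_deriv ?_
  simp only [profileDeriv₃, profileDeriv₂, Pi.sub_apply, id, Pi.inv_apply, Pi.pow_apply]
  field_simp
  ring

/-- Coefficients of the inverse of `coordHess`. -/
noncomputable def coordHessInv : Fin 3 → Fin 3 → ℝ := ![![0, 0, 1], ![0, -(1 / 2), 0], ![1, 0, 0]]

/-- Sherman–Morrison for the rank-one perturbation `φQ + φ' u uᵀ`: since `Q⁻¹u = x`, the correction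
to `Q⁻¹` is `-φ'/(φ + 2dφ') x xᵀ`, and the differential equation gives `φ + 2dφ' = -4/(4d-1)`. -/
theorem kmbGram_inv_apply {x : Fin 3 → ℝ} (hx : 1 / 4 < coordDet x) (i j : Fin 3) :
    (kmbGram x)⁻¹ i j = -2 / profile (coordDet x) * (coordHessInv i j
      + profileDeriv (coordDet x) * (4 * coordDet x - 1) / 4 * (x i * x j)) := by
  let N : Matrix (Fin 3) (Fin 3) ℝ := Matrix.of fun i j =>
    -2 / profile (coordDet x) * (coordHessInv i j
      + profileDeriv (coordDet x) * (4 * coordDet x - 1) / 4 * (x i * x j))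
  have hp := (profile_pos hx).ne'
  have hrel := profileDeriv_relation hx
  have hN : kmbGram x * N = 1 := by
    ext k l
    have hu : ∑ m, coordGrad x m * x m = 2 * coordDet x := by
      simp [Fin.sum_univ_three, coordGrad, coordDet]
      ring
    have hq : ∑ m, coordHess k m * x m = coordGrad x k := by
      fin_cases k <;> simp [Fin.sum_univ_three, coordGrad, coordHess]
    have hv : ∑ m, coordGrad x m * coordHessInv m l = x l := by
      fin_cases l <;> simp [Fin.sum_univ_three, coordGrad, coordHessInv]
      ring
    have hqq : ∑ m, coordHess k m * coordHessInv m l = (1 : Matrix (Fin 3) (Fin 3) ℝ) k l := by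
      fin_cases k <;> fin_cases l <;> simp [Fin.sum_univ_three, coordHess, coordHessInv]
    simp only [Matrix.mul_apply, kmbGram_apply hx, N, Matrix.of_apply]
    rw [← hqq]
    simp only [Fin.sum_univ_three] at *
    generalize profile (coordDet x) = p at *
    generalize profileDeriv (coordDet x) = q at *
    field_simp
    linear_combination (4 * q * coordGrad x k) * hv + (q ^ 2 * (4 * coordDet x - 1) *
      coordGrad x k * x l) * hu + p * q * (4 * coordDet x - 1) * x l * hq +
      q * coordGrad x k * x l * hrel
  rw [Matrix.inv_eq_right_inv hN]
  rfl

/-- First coefficient of the Christoffel symbols of the KMB metric. -/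
noncomputable def christoffelGG (d : ℝ) : ℝ :=
  -((4 * d - 1) * (profileDeriv₂ d / 8 - profileDeriv d ^ 2 / (4 * profile d)))

/-- Second coefficient of the Christoffel symbols of the KMB metric. -/
noncomputable def christoffelHess (d : ℝ) : ℝ := -((4 * d - 1) * profileDeriv d / 8)

/-- Third coefficient of the Christoffel symbols of the KMB metric. -/
noncomputable def christoffelDelta (d : ℝ) : ℝ := profileDeriv d / (2 * profile d)

theorem partialDeriv_kmbGram {x : Fin 3 → ℝ} (hx : 1 / 4 < coordDet x) (i j l : Fin 3) :
    partialDeriv l (fun y => kmbGram y i j) x = -(1 / 2) *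
      (profileDeriv₂ (coordDet x) * (coordGrad x i * coordGrad x j * coordGrad x l) +
        profileDeriv (coordDet x) * (coordHess l i * coordGrad x j + coordGrad x i * coordHess l j
          + coordGrad x l * coordHess i j)) := by
  refine partialDeriv_eq_of_eqOn hx (fun y hy => kmbGram_apply hy i j) ?_
  have hu := hasDerivAt_line_coordGrad x l
  refine (((((hasDerivAt_line_comp_coordDet (hasDerivAt_profileDeriv hx) l).mul (hu i)).mul
    (hu j)).add ((hasDerivAt_line_comp_coordDet (hasDerivAt_profile hx) l).mul_const
      (coordHess i j))).const_mul (-(1 / 2))).congr_deriv ?_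
  simp only [zero_smul, add_zero, Pi.mul_apply]
  ring

theorem coordHess_comm (i j : Fin 3) : coordHess i j = coordHess j i := by
  fin_cases i <;> fin_cases j <;> rfl

/-- For a Hessian metric `∂ₗgᵢⱼ` is totally symmetric, so the bracket in the Christoffel symbol
collapses to a single third derivative, whose index is then raised. -/
theorem christoffel_kmbGram {x : Fin 3 → ℝ} (hx : 1 / 4 < coordDet x) (k i j : Fin 3) :
    christoffel kmbGram k i j x =
      coneChristoffel christoffelGG christoffelHess christoffelDelta k i j x := by
  have hp := (profile_pos hx).ne'
  have hrel := profileDeriv_relation hx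
  have hu : ∑ m, x m * coordGrad x m = 2 * coordDet x := by
    simp [Fin.sum_univ_three, coordGrad, coordDet]
    ring
  have hq (i : Fin 3) : ∑ m, x m * coordHess i m = coordGrad x i := by
    fin_cases i <;> simp [Fin.sum_univ_three, coordGrad, coordHess]
    ring
  have hv : ∑ m, coordHessInv k m * coordGrad x m = x k := by
    fin_cases k <;> simp [Fin.sum_univ_three, coordGrad, coordHessInv]
  have hqq (i : Fin 3) : ∑ m, coordHessInv k m * coordHess i m = if k = i then 1 else 0 := by
    fin_cases k <;> fin_cases i <;> simp [Fin.sum_univ_three, coordHess, coordHessInv]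
  have hqi := hq i
  have hqj := hq j
  have hqqi := hqq i
  have hqqj := hqq j
  simp only [christoffel, partialDeriv_kmbGram hx, kmbGram_inv_apply hx, coneChristoffel,
    christoffelGG, christoffelHess, christoffelDelta, ← hqqi, ← hqqj]
  simp only [coordHess_comm 0 i, coordHess_comm 1 i, coordHess_comm 2 i, coordHess_comm 0 j,
    coordHess_comm 1 j, coordHess_comm 2 j, coordHess_comm j i, Fin.sum_univ_three] at *
  generalize profile (coordDet x) = p at *
  generalize profileDeriv (coordDet x) = q at *
  generalize profileDeriv₂ (coordDet x) = r at *
  generalize coordDet x = d at *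
  -- The factor `1 + 2dκ`, with `κ` the coefficient of `x xᵀ` in the inverse, appears when `u` is
  -- raised; being a multiple of `φ`, it cancels the `1/φ` of the inverse metric.
  have hκ : 1 + 2 * d * (q * (4 * d - 1) / 4) = -((4 * d - 1) * p / 4) := by
    linear_combination hrel / 4
  have hp' : p * p⁻¹ = 1 := mul_inv_cancel₀ hp
  linear_combination (p⁻¹ / 2 * (r * coordGrad x i * coordGrad x j + q * coordHess i j)) *
      (hv + q * (4 * d - 1) / 4 * x k * hu + x k * hκ) +
    (p⁻¹ * q / 2 * (q * (4 * d - 1) / 4) * x k) * (coordGrad x j * hqi + coordGrad x i * hqj) +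
    (-(4 * d - 1) / 8 * x k * (r * coordGrad x i * coordGrad x j + q * coordHess i j)) * hp'

theorem scal_eq {V : Matrix (Fin 2) (Fin 2) ℝ} (hV : 1 / 4 < coordDet (coord V)) {d : ℝ}
    (hd : coordDet (coord V) = d) :
    scal V = -2 + (4 * d - 1) / (8 * d) - 1 / (d * profile d)
      - 2 / ((4 * d - 1) * (d * profile d)) + 2 / ((4 * d - 1) * (d * profile d ^ 2)) := by
  set x := coord V
  have hp := (profile_pos hV).ne'
  have h1 : 4 * d - 1 ≠ 0 := by rw [← hd]; linarith
  have h2 : d ≠ 0 := by rw [← hd]; linarith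
  have hl : HasDerivAt (fun d : ℝ => 4 * d - 1) 4 (coordDet x) := by
    simpa using ((hasDerivAt_id (coordDet x)).const_mul 4).sub_const 1
  have hα := (hl.mul (((hasDerivAt_profileDeriv₂ hV).div_const 8).sub
    (((hasDerivAt_profileDeriv hV).pow 2).div ((hasDerivAt_profile hV).const_mul 4)
      (mul_ne_zero four_ne_zero hp)))).neg
  have hβ := ((hl.mul (hasDerivAt_profileDeriv hV)).div_const 8).neg
  have hγ := (hasDerivAt_profileDeriv hV).div ((hasDerivAt_profile hV).const_mul 2)
    (mul_ne_zero two_ne_zero hp)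
  have hR (j k : Fin 3) := ricci_of_christoffel hV (fun k i j y hy => christoffel_kmbGram hy k i j)
    hα hβ hγ j k hd rfl rfl rfl
  have hd' : x 0 * x 2 - x 1 * x 1 = d := hd
  -- The contractions used are `uᵀQ⁻¹u = 2d`, `(u·x)² = 4d²`, `tr(Q⁻¹Q) = 3` and `xᵀQx = 2d`.
  have hcontr (P W κ s : ℝ) : ∑ j, ∑ k, s * (coordHessInv j k + κ * (x j * x k)) *
      (P * (coordGrad x j * coordGrad x k) + W * coordHess j k) =
      s * (P * (2 * d + 4 * d ^ 2 * κ) + W * (3 + 2 * d * κ)) := by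
    rw [← hd']
    simp [Fin.sum_univ_three, coordGrad, coordHess, coordHessInv]
    ring
  rw [scal, scalarCurvature]
  refine (Finset.sum_congr rfl fun j _ => Finset.sum_congr rfl fun k _ => by
    rw [kmbGram_inv_apply hV, hR]).trans ?_
  rw [hcontr, hd]
  rw [hd] at hp
  simp only [christoffelGG, christoffelHess, christoffelDelta, profileDeriv₂, profileDeriv]
  generalize profile d = p at *
  field_simp
  ring

/-! ### Monotonicity and limits of the scalar curvature -/

theorem sinh_le_mul_cosh {t : ℝ} (ht : 0 ≤ t) : Real.sinh t ≤ t * Real.cosh t := by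
  have hder (x : ℝ) : HasDerivAt (fun x => x * Real.cosh x - Real.sinh x) (x * Real.sinh x) x := by
    refine (((hasDerivAt_id x).mul (Real.hasDerivAt_cosh x)).sub
      (Real.hasDerivAt_sinh x)).congr_deriv ?_
    simp
  have hmono : MonotoneOn (fun x => x * Real.cosh x - Real.sinh x) (Set.Ici 0) := by
    refine monotoneOn_of_deriv_nonneg (convex_Ici 0)
      (fun x _ => (hder x).continuousAt.continuousWithinAt)
      (fun x _ => (hder x).differentiableAt.differentiableWithinAt) fun x hx => ?_
    rw [interior_Ici] at hx
    rw [(hder x).deriv]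
    exact mul_nonneg hx.le (Real.sinh_nonneg_iff.mpr hx.le)
  simpa using hmono Set.self_mem_Ici ht ht

/-- The scalar curvature, up to sign and an additive constant, in terms of half the inverse
temperature. -/
noncomputable def curvatureProfile (t : ℝ) : ℝ :=
  (1 / 2) * (Real.sinh t / Real.cosh t) ^ 2 - Real.sinh t / t / Real.cosh t +
    2 * (Real.sinh t / t) * Real.cosh t - (1 / 2) * (Real.sinh t / t) ^ 2

/-- The derivative is grouped into pieces whose signs follow from `t ≤ sinh t ≤ t cosh t` and `cosh
t ≥ 1`; the first piece is strictly positive. -/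
theorem strictMonoOn_curvatureProfile : StrictMonoOn curvatureProfile (Set.Ioi 0) := by
  have hder (t : ℝ) (ht : 0 < t) : HasDerivAt curvatureProfile
      (Real.sinh t / Real.cosh t ^ 3 + (Real.sinh t * Real.cosh t - t) / (Real.cosh t ^ 2 * t ^ 2) +
        ((t * Real.cosh t - Real.sinh t) * (2 * (t * Real.cosh t) - Real.sinh t) +
          2 * (t ^ 2 * Real.sinh t ^ 2)) / t ^ 3) t := by
    have hc := (Real.cosh_pos t).ne'
    have h1 := (Real.hasDerivAt_sinh t).div (Real.hasDerivAt_cosh t) hc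
    have h2 := (Real.hasDerivAt_sinh t).div (hasDerivAt_id t) ht.ne'
    refine (((((h1.pow 2).const_mul (1 / 2)).sub (h2.div (Real.hasDerivAt_cosh t) hc)).add
      ((h2.const_mul 2).mul (Real.hasDerivAt_cosh t))).sub
        ((h2.pow 2).const_mul (1 / 2))).congr_deriv ?_
    have e := Real.cosh_sq_sub_sinh_sq t
    simp only [Pi.div_apply, id, Nat.cast_ofNat, Nat.add_one_sub_one, pow_one]
    generalize Real.cosh t = c at *
    generalize Real.sinh t = s at *
    have ht' := ht.ne'
    have e' : s ^ 2 = c ^ 2 - 1 := by linear_combination -e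
    field_simp
    have e3 : s ^ 3 = s * (c ^ 2 - 1) := by rw [← e']; ring
    ring_nf
    simp only [e', e3]
    ring
  refine strictMonoOn_of_deriv_pos (convex_Ioi 0)
    (fun x hx => (hder x hx).continuousAt.continuousWithinAt) fun t ht => ?_
  rw [interior_Ioi] at ht
  have ht : 0 < t := ht
  rw [(hder t ht).deriv]
  have hs : 0 < Real.sinh t := Real.sinh_pos_iff.mpr ht
  have hc := Real.one_le_cosh t
  have h1 : t ≤ Real.sinh t := Real.self_le_sinh_iff.mpr ht.le
  have h2 := sinh_le_mul_cosh ht.le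
  have h3 : 0 ≤ Real.sinh t * Real.cosh t - t := by nlinarith
  have h4 : 0 ≤ (t * Real.cosh t - Real.sinh t) * (2 * (t * Real.cosh t) - Real.sinh t) :=
    mul_nonneg (by linarith) (by linarith)
  have h5 : 0 < Real.cosh t := by linarith
  positivity

/-- Put `r = sinh t / t`, so `1 ≤ r ≤ cosh t`. Then `2r cosh t - r²/2 ≥ cosh t ≥ t`, while the only
other negative term is at least `-1`; hence the lower bound `t - 1`. -/
theorem tendsto_curvatureProfile_atTop :
    Filter.Tendsto curvatureProfile Filter.atTop Filter.atTop := by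
  have hlin : Filter.Tendsto (fun t : ℝ => t + -1) Filter.atTop Filter.atTop :=
    Filter.tendsto_atTop_add_const_right _ _ Filter.tendsto_id
  refine Filter.tendsto_atTop_mono' _ ?_ hlin
  filter_upwards [Filter.eventually_gt_atTop 0] with t ht
  have hc : 0 < Real.cosh t := Real.cosh_pos t
  have h1 : 1 ≤ Real.sinh t / t := by
    rw [one_le_div ht]
    exact Real.self_le_sinh_iff.mpr ht.le
  have h2 : Real.sinh t / t ≤ Real.cosh t := by
    rw [div_le_iff₀ ht, mul_comm]
    exact sinh_le_mul_cosh ht.le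
  have h3 : Real.sinh t / t / Real.cosh t ≤ 1 := (div_le_one hc).mpr h2
  have h4 : t ≤ Real.cosh t :=
    (Real.self_le_sinh_iff.mpr ht.le).trans (Real.sinh_lt_cosh t).le
  have h5 : 0 ≤ (1 / 2) * (Real.sinh t / Real.cosh t) ^ 2 := by positivity
  rw [curvatureProfile]
  nlinarith [mul_nonneg (sub_nonneg.mpr h1) (sub_nonneg.mpr h2),
    mul_nonneg (sub_nonneg.mpr h1) hc.le]

theorem tendsto_curvatureProfile_zero :
    Filter.Tendsto curvatureProfile (nhdsWithin 0 (Set.Ioi 0)) (nhds (1 / 2)) := by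
  have hs : Filter.Tendsto (fun t => Real.sinh t / t) (nhdsWithin 0 (Set.Ioi 0)) (nhds 1) := by
    have h := (Real.hasDerivAt_sinh 0).tendsto_slope_zero_right
    simp only [zero_add, Real.sinh_zero, sub_zero, Real.cosh_zero, smul_eq_mul] at h
    exact h.congr fun t => by rw [div_eq_inv_mul]
  have hle : nhdsWithin (0 : ℝ) (Set.Ioi 0) ≤ nhds 0 := nhdsWithin_le_nhds
  have hc : Filter.Tendsto Real.cosh (nhdsWithin 0 (Set.Ioi 0)) (nhds 1) := by
    simpa using (Real.continuous_cosh.tendsto 0).mono_left hle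
  have hs0 : Filter.Tendsto Real.sinh (nhdsWithin 0 (Set.Ioi 0)) (nhds 0) := by
    simpa using (Real.continuous_sinh.tendsto 0).mono_left hle
  have h := (((((hs0.div hc one_ne_zero).pow 2).const_mul (1 / 2)).sub
    (hs.div hc one_ne_zero)).add ((hs.const_mul 2).mul hc)).sub ((hs.pow 2).const_mul (1 / 2))
  norm_num at h
  norm_num
  exact h

/-! ### The inverse temperature as a function of the symplectic eigenvalue -/

theorem tendsto_artanh_atTop :
    Filter.Tendsto Real.artanh (nhdsWithin 1 (Set.Iio 1)) Filter.atTop := by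
  refine Filter.tendsto_atTop.mpr fun M => ?_
  filter_upwards [Ioo_mem_nhdsLT (Real.tanh_lt_one M)] with y hy
  rw [← Real.artanh_tanh M]
  exact Real.artanh_le_artanh (Real.neg_one_lt_tanh M) hy.2 hy.1.le

theorem tanh_pos {t : ℝ} (ht : 0 < t) : 0 < Real.tanh t := by
  rw [Real.tanh_eq_sinh_div_cosh]
  exact div_pos (Real.sinh_pos_iff.mpr ht) (Real.cosh_pos t)

theorem tendsto_artanh_zero :
    Filter.Tendsto Real.artanh (nhdsWithin 0 (Set.Ioi 0)) (nhdsWithin 0 (Set.Ioi 0)) := by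
  refine tendsto_nhdsWithin_iff.mpr ⟨?_, ?_⟩
  · refine tendsto_order.mpr ⟨fun e he => ?_, fun e he => ?_⟩
    · filter_upwards [self_mem_nhdsWithin] with y hy
      exact he.trans_le (Real.artanh_nonneg (le_of_lt hy))
    · filter_upwards [Ioo_mem_nhdsGT (tanh_pos he)] with y hy
      rw [← Real.artanh_tanh e]
      exact Real.artanh_lt_artanh (by linarith [hy.1]) (Real.tanh_lt_one e) hy.2
  · filter_upwards [Ioo_mem_nhdsGT (zero_lt_one (α := ℝ))] with y hy
    exact Real.artanh_pos hy

/-- Half the inverse temperature of the state with symplectic eigenvalue `ν`. -/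
noncomputable def halfBeta (ν : ℝ) : ℝ := Real.artanh (1 / (2 * ν))

theorem one_div_two_mul_mem {ν : ℝ} (hν : 1 / 2 < ν) : 1 / (2 * ν) ∈ Set.Ioo (0 : ℝ) 1 :=
  ⟨by positivity, by rw [div_lt_one (by linarith)]; linarith⟩

theorem halfBeta_pos {ν : ℝ} (hν : 1 / 2 < ν) : 0 < halfBeta ν :=
  Real.artanh_pos (one_div_two_mul_mem hν)

theorem tanh_halfBeta {ν : ℝ} (hν : 1 / 2 < ν) : Real.tanh (halfBeta ν) = 1 / (2 * ν) :=
  Real.tanh_artanh ⟨by linarith [(one_div_two_mul_mem hν).1], (one_div_two_mul_mem hν).2⟩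

theorem strictAntiOn_halfBeta : StrictAntiOn halfBeta (Set.Ioi (1 / 2)) := by
  intro x hx y hy hxy
  have hx' : 1 / 2 < x := hx
  exact Real.artanh_lt_artanh (by linarith [(one_div_two_mul_mem hy).1])
    (one_div_two_mul_mem hx).2 (one_div_lt_one_div_of_lt (by linarith) (by linarith))

theorem tendsto_halfBeta_atTop :
    Filter.Tendsto halfBeta Filter.atTop (nhdsWithin 0 (Set.Ioi 0)) := by
  refine tendsto_artanh_zero.comp (tendsto_nhdsWithin_iff.mpr ⟨?_, ?_⟩)
  · exact tendsto_const_nhds.div_atTop (Filter.tendsto_id.const_mul_atTop two_pos)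
  · filter_upwards [Filter.eventually_gt_atTop (1 / 2)] with ν hν
    exact (one_div_two_mul_mem hν).1

theorem tendsto_halfBeta_half :
    Filter.Tendsto halfBeta (nhdsWithin (1 / 2) (Set.Ioi (1 / 2))) Filter.atTop := by
  refine tendsto_artanh_atTop.comp (tendsto_nhdsWithin_iff.mpr ⟨?_, ?_⟩)
  · have h : ContinuousAt (fun ν : ℝ => 1 / (2 * ν)) (1 / 2) :=
      continuousAt_const.div (by fun_prop) (by norm_num)
    have := h.tendsto.mono_left (nhdsWithin_le_nhds (s := Set.Ioi (1 / 2)))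
    norm_num at this ⊢
    exact this
  · filter_upwards [self_mem_nhdsWithin] with ν hν
    exact (one_div_two_mul_mem hν).2

theorem profile_sq {ν : ℝ} (hν : 1 / 2 < ν) : profile (ν ^ 2) = 2 * halfBeta ν / ν := by
  have h0 : 0 < ν := by linarith
  have hm := one_div_two_mul_mem hν
  rw [profile, Real.sqrt_sq h0.le, halfBeta,
    Real.artanh_eq_half_log ⟨by linarith [hm.1], hm.2.le⟩]
  have e : (1 + 1 / (2 * ν)) / (1 - 1 / (2 * ν)) = (2 * ν + 1) / (2 * ν - 1) := by
    have h1 : 2 * ν - 1 ≠ 0 := by linarith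
    have h2 : 1 - 1 / (2 * ν) ≠ 0 := by linarith [hm.2]
    rw [div_eq_div_iff h2 h1]
    field_simp
  rw [e]
  ring

/-- With `2ν = coth t` one has `4d - 1 = 1/sinh² t`, `dφ = 2tν` and `dφ² = 4t²`, which turns
`scal_eq` into hyperbolic functions. -/
theorem scal_eq_of_coordDet {V : Matrix (Fin 2) (Fin 2) ℝ} {ν : ℝ} (hν : 1 / 2 < ν)
    (hd : coordDet (coord V) = ν ^ 2) :
    scal V = -(3 / 2) - curvatureProfile (halfBeta ν) := by
  have hV : 1 / 4 < coordDet (coord V) := by rw [hd]; nlinarith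
  rw [scal_eq hV hd, profile_sq hν, curvatureProfile]
  have ht := halfBeta_pos hν
  have hth := tanh_halfBeta hν
  rw [Real.tanh_eq_sinh_div_cosh] at hth
  have e := Real.cosh_sq_sub_sinh_sq (halfBeta ν)
  have hs : 0 < Real.sinh (halfBeta ν) := Real.sinh_pos_iff.mpr ht
  have hc : 0 < Real.cosh (halfBeta ν) := Real.cosh_pos _
  generalize halfBeta ν = t at *
  generalize Real.cosh t = c at *
  generalize Real.sinh t = s at *
  have hν0 : ν ≠ 0 := by linarith
  have hνe : ν = c / (2 * s) := by
    field_simp at hth ⊢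
    linarith
  have h4 : 4 * ν ^ 2 - 1 = 1 / s ^ 2 := by
    rw [hνe]
    field_simp
    linear_combination 4 * e
  rw [h4, hνe]
  have e' : c ^ 2 = 1 + s ^ 2 := by linear_combination e
  field_simp
  ring_nf
  have e3 : c ^ 3 = c * (1 + s ^ 2) := by rw [← e']; ring
  simp only [e', e3]
  ring

theorem coordDet_coord_smul_one (ν : ℝ) :
    coordDet (coord (ν • (1 : Matrix (Fin 2) (Fin 2) ℝ))) = ν ^ 2 := by
  simp [coordDet, coord, sq]

theorem scal_smul_one {ν : ℝ} (hν : 1 / 2 < ν) :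
    scal (ν • (1 : Matrix (Fin 2) (Fin 2) ℝ)) = -(3 / 2) - curvatureProfile (halfBeta ν) :=
  scal_eq_of_coordDet hν (coordDet_coord_smul_one ν)

theorem strictMonoOn_scal :
    StrictMonoOn (fun ν : ℝ => scal (ν • (1 : Matrix (Fin 2) (Fin 2) ℝ))) (Set.Ioi (1 / 2)) := by
  intro x hx y hy hxy
  have h := strictMonoOn_curvatureProfile (halfBeta_pos hy) (halfBeta_pos hx)
    (strictAntiOn_halfBeta hx hy hxy)
  simp only [scal_smul_one hx, scal_smul_one hy]
  linarith

theorem tendsto_scal_atTop :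
    Filter.Tendsto (fun ν : ℝ => scal (ν • (1 : Matrix (Fin 2) (Fin 2) ℝ)))
      Filter.atTop (nhds (-2)) := by
  have h := (tendsto_curvatureProfile_zero.comp tendsto_halfBeta_atTop).const_sub (-(3 / 2))
  norm_num at h
  refine h.congr' ?_
  filter_upwards [Filter.eventually_gt_atTop (1 / 2)] with ν hν
  rw [scal_smul_one hν]

theorem tendsto_scal_half :
    Filter.Tendsto (fun ν : ℝ => scal (ν • (1 : Matrix (Fin 2) (Fin 2) ℝ)))
      (nhdsWithin (1 / 2) (Set.Ioi (1 / 2))) Filter.atBot := by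
  have h := Filter.tendsto_atBot_add_const_left _ (-(3 / 2)) (Filter.tendsto_neg_atTop_atBot.comp
    (tendsto_curvatureProfile_atTop.comp tendsto_halfBeta_half))
  refine h.congr' ?_
  filter_upwards [self_mem_nhdsWithin] with ν hν
  rw [scal_smul_one hν]
  rfl

/-! ### The spectrum of a harmonic oscillator from its ladder operators -/

section Ladder

variable {E : Type*} [AddCommGroup E] [Module ℂ E] {A B : Module.End ℂ E} {κ : ℝ}

theorem mem_eigenspace_ladder {μ : ℂ} {ψ : E} :
    ψ ∈ Module.End.eigenspace (B * A) μ ↔ B (A ψ) = μ • ψ := by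
  rw [Module.End.mem_eigenspace_iff, Module.End.mul_apply]

theorem ladder_lower (hcomm : A * B = B * A + (κ : ℂ) • 1) {μ : ℂ} {ψ : E}
    (h : B (A ψ) = μ • ψ) : B (A (A ψ)) = (μ - κ) • A ψ := by
  have := LinearMap.congr_fun hcomm (A ψ)
  simp only [Module.End.mul_apply, LinearMap.add_apply, LinearMap.smul_apply,
    Module.End.one_apply, h, map_smul] at this
  rw [sub_smul, this, add_sub_cancel_right]

theorem ladder_raise (hcomm : A * B = B * A + (κ : ℂ) • 1) {μ : ℂ} {ψ : E}
    (h : B (A ψ) = μ • ψ) : A (B ψ) = (μ + κ) • ψ := by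
  have := LinearMap.congr_fun hcomm ψ
  simp only [Module.End.mul_apply, LinearMap.add_apply, LinearMap.smul_apply,
    Module.End.one_apply, h] at this
  rw [add_smul, this]

/-- The raising operator as an equivalence between consecutive eigenspaces. -/
noncomputable def ladderEquiv (hcomm : A * B = B * A + (κ : ℂ) • 1) {μ : ℂ} (hμ : μ + κ ≠ 0) :
    Module.End.eigenspace (B * A) μ ≃ₗ[ℂ] Module.End.eigenspace (B * A) (μ + κ) where
  toFun ψ := ⟨B ψ, by
    rw [mem_eigenspace_ladder, ladder_raise hcomm (mem_eigenspace_ladder.mp ψ.2), map_smul]⟩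
  map_add' ψ χ := by simp
  map_smul' z ψ := by simp
  -- `AB` on the lower eigenspace and `BA` on the upper one are both multiplication by `μ + κ`.
  invFun ψ := ⟨(μ + κ)⁻¹ • A ψ, by
    have := ladder_lower hcomm (mem_eigenspace_ladder.mp ψ.2)
    rw [mem_eigenspace_ladder, map_smul, map_smul, this, add_sub_cancel_right, smul_comm]⟩
  left_inv ψ := by
    ext
    simp only
    rw [ladder_raise hcomm (mem_eigenspace_ladder.mp ψ.2), inv_smul_smul₀ hμ]
  right_inv ψ := by
    ext
    simp only
    rw [map_smul, mem_eigenspace_ladder.mp ψ.2, inv_smul_smul₀ hμ]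

theorem finrank_eigenspace_ladder (hκ : 0 < κ) (hcomm : A * B = B * A + (κ : ℂ) • 1)
    (hker : ∀ ψ, B (A ψ) = 0 → A ψ = 0) (hone : Module.finrank ℂ (LinearMap.ker A) = 1) (n : ℕ) :
    Module.finrank ℂ (Module.End.eigenspace (B * A) ((n * κ : ℝ) : ℂ)) = 1 := by
  induction n with
  | zero =>
    have : Module.End.eigenspace (B * A) (((0 : ℕ) * κ : ℝ) : ℂ) = LinearMap.ker A := by
      ext ψ
      rw [mem_eigenspace_ladder, LinearMap.mem_ker]
      simp only [Nat.cast_zero, zero_mul, Complex.ofReal_zero, zero_smul]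
      exact ⟨hker ψ, fun h => by rw [h, map_zero]⟩
    rw [this, hone]
  | succ n ih =>
    have e : (((n + 1 : ℕ) * κ : ℝ) : ℂ) = ((n * κ : ℝ) : ℂ) + κ := by
      push_cast
      ring
    have hne : ((n * κ : ℝ) : ℂ) + κ ≠ 0 := by
      rw [← Complex.ofReal_add]
      exact_mod_cast (by positivity : (n * κ + κ : ℝ) ≠ 0)
    rw [e, ← (ladderEquiv hcomm hne).finrank_eq, ih]

theorem eigenspace_ladder_eq_bot (hcomm : A * B = B * A + (κ : ℂ) • 1) (hκ : 0 < κ)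
    (hneg : ∀ (μ : ℝ) (ψ : E), μ < 0 → B (A ψ) = (μ : ℂ) • ψ → ψ = 0) {μ : ℝ}
    (hμ : ∀ n : ℕ, μ ≠ n * κ) : Module.End.eigenspace (B * A) (μ : ℂ) = ⊥ := by
  -- Induction on strips of width `κ`: lowering moves an eigenvector one strip down, and below zero
  -- there are none. If `A` kills it, then `μψ = 0`, and `μ ≠ 0` by the case `m = 0`.
  have key (n : ℕ) : ∀ (μ : ℝ) (ψ : E), μ < n * κ → (∀ m : ℕ, μ ≠ m * κ) →
      B (A ψ) = (μ : ℂ) • ψ → ψ = 0 := by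
    induction n with
    | zero => exact fun μ ψ hlt _ => hneg μ ψ (by simpa using hlt)
    | succ n ih =>
      intro μ ψ hlt hne h
      have hA : A ψ = 0 := by
        refine ih (μ - κ) (A ψ) ?_ (fun m hm => hne (m + 1) ?_) ?_
        · push_cast at hlt
          linarith
        · push_cast
          linarith
        · simpa using ladder_lower hcomm h
      rw [hA, map_zero] at h
      refine (smul_eq_zero.mp h.symm).resolve_left ?_
      exact_mod_cast fun h0 : μ = 0 => hne 0 (by simpa using h0)
  obtain ⟨n, hn⟩ := exists_nat_gt (μ / κ)
  refine (Submodule.eq_bot_iff _).mpr fun ψ hψ => key n μ ψ ?_ hμ (mem_eigenspace_ladder.mp hψ)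
  rwa [div_lt_iff₀ hκ] at hn

end Ladder

/-! ### Gaussian Schwartz functions -/

/-- Bound `|x|^k` by `1 + x^(2k)` and `x^(2k)` by a multiple of `exp(c x²)`, using one term of the
exponential series. -/
theorem exists_pow_mul_exp_le {c : ℝ} (hc : 0 < c) (k : ℕ) :
    ∃ C : ℝ, ∀ x : ℝ, |x| ^ k * Real.exp (-(c * x ^ 2)) ≤ C := by
  refine ⟨1 + k.factorial / c ^ k, fun x => ?_⟩
  have h1 : |x| ^ k ≤ 1 + (x ^ 2) ^ k := by
    rw [← sq_abs, ← pow_mul, mul_comm, pow_mul]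
    nlinarith [sq_nonneg (|x| ^ k - 1)]
  have h2 : (x ^ 2) ^ k ≤ k.factorial / c ^ k * Real.exp (c * x ^ 2) := by
    have := Real.pow_div_factorial_le_exp (c * x ^ 2) (by positivity) k
    rw [div_le_iff₀ (by positivity), mul_pow] at this
    rw [div_mul_eq_mul_div, le_div_iff₀ (by positivity)]
    linarith
  have h3 : Real.exp (c * x ^ 2) * Real.exp (-(c * x ^ 2)) = 1 := by
    rw [← Real.exp_add, add_neg_cancel, Real.exp_zero]
  have h4 : Real.exp (-(c * x ^ 2)) ≤ 1 := by
    rw [Real.exp_le_one_iff, neg_nonpos]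
    positivity
  have h5 := Real.exp_pos (-(c * x ^ 2))
  calc |x| ^ k * Real.exp (-(c * x ^ 2)) ≤ (1 + (x ^ 2) ^ k) * Real.exp (-(c * x ^ 2)) := by gcongr
    _ ≤ (1 + k.factorial / c ^ k * Real.exp (c * x ^ 2)) * Real.exp (-(c * x ^ 2)) := by gcongr
    _ = Real.exp (-(c * x ^ 2)) + k.factorial / c ^ k := by
      rw [add_mul, one_mul, mul_assoc, h3, mul_one]
    _ ≤ 1 + k.factorial / c ^ k := by gcongr

/-- The complex Gaussian `exp (-z x² / 2)`. -/
noncomputable def gaussianFun (z : ℂ) (x : ℝ) : ℂ := Complex.exp (-(z / 2) * (x : ℂ) ^ 2)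

theorem norm_gaussianFun (z : ℂ) (x : ℝ) :
    ‖gaussianFun z x‖ = Real.exp (-(z.re / 2 * x ^ 2)) := by
  rw [gaussianFun, Complex.norm_exp, ← Complex.ofReal_pow, Complex.re_mul_ofReal]
  simp

theorem hasDerivAt_gaussianFun (z : ℂ) (x : ℝ) :
    HasDerivAt (gaussianFun z) (-(z * x) * gaussianFun z x) x := by
  have h : HasDerivAt (fun w : ℂ => Complex.exp (-(z / 2) * w ^ 2))
      (-(z * x) * gaussianFun z x) (x : ℂ) := by
    refine (((hasDerivAt_id (x : ℂ)).pow 2).const_mul (-(z / 2))).cexp.congr_deriv ?_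
    simp [gaussianFun]
    ring
  exact h.comp_ofReal

theorem contDiff_gaussianFun (z : ℂ) (n : WithTop ℕ∞) : ContDiff ℝ n (gaussianFun z) := by
  have : ContDiff ℝ n (fun x : ℝ => (x : ℂ)) := Complex.ofRealCLM.contDiff
  exact (contDiff_const.mul (this.pow 2)).cexp

theorem iteratedDeriv_gaussianFun (z : ℂ) (n : ℕ) :
    ∃ P : Polynomial ℂ, ∀ x : ℝ, iteratedDeriv n (gaussianFun z) x =
      P.eval (x : ℂ) * gaussianFun z x := by
  induction n with
  | zero => exact ⟨1, fun x => by simp⟩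
  | succ n ih =>
    obtain ⟨P, hP⟩ := ih
    refine ⟨P.derivative - Polynomial.C z * Polynomial.X * P, fun x => ?_⟩
    rw [iteratedDeriv_succ, funext hP]
    refine ((P.hasDerivAt (x : ℂ)).comp_ofReal.mul (hasDerivAt_gaussianFun z x)).deriv.trans ?_
    simp
    ring

theorem exists_eval_mul_gaussianFun_le {z : ℂ} (hz : 0 < z.re) (P : Polynomial ℂ) (k : ℕ) :
    ∃ C : ℝ, ∀ x : ℝ, |x| ^ k * ‖P.eval (x : ℂ) * gaussianFun z x‖ ≤ C := by
  induction P using Polynomial.induction_on' with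
  | add P Q hP hQ =>
    obtain ⟨C, hC⟩ := hP
    obtain ⟨D, hD⟩ := hQ
    refine ⟨C + D, fun x => ?_⟩
    calc |x| ^ k * ‖(P + Q).eval (x : ℂ) * gaussianFun z x‖
        ≤ |x| ^ k * (‖P.eval (x : ℂ) * gaussianFun z x‖ + ‖Q.eval (x : ℂ) * gaussianFun z x‖) := by
          rw [Polynomial.eval_add, add_mul]
          gcongr
          exact norm_add_le _ _
      _ ≤ C + D := by
          rw [mul_add]
          exact add_le_add (hC x) (hD x)
  | monomial n a =>
    obtain ⟨C, hC⟩ := exists_pow_mul_exp_le (half_pos hz) (k + n)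
    refine ⟨‖a‖ * C, fun x => ?_⟩
    rw [Polynomial.eval_monomial, norm_mul, norm_mul, norm_pow, norm_gaussianFun,
      Complex.norm_real, Real.norm_eq_abs]
    refine le_of_eq_of_le ?_ (mul_le_mul_of_nonneg_left (hC x) (norm_nonneg a))
    ring

/-- The complex Gaussian `exp (-z x² / 2)` as a Schwartz function. -/
noncomputable def gaussian (z : ℂ) (hz : 0 < z.re) : SchwartzMap ℝ ℂ where
  toFun := gaussianFun z
  smooth' := contDiff_gaussianFun z _
  decay' k n := by
    obtain ⟨P, hP⟩ := iteratedDeriv_gaussianFun z n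
    obtain ⟨C, hC⟩ := exists_eval_mul_gaussianFun_le hz P k
    refine ⟨C, fun x => ?_⟩
    rw [norm_iteratedFDeriv_eq_norm_iteratedDeriv, hP, Real.norm_eq_abs]
    exact hC x

/-! ### Ladder operators of a quadratic Hamiltonian -/

theorem position_apply (f : SchwartzMap ℝ ℂ) (x : ℝ) : position f x = x * f x := by
  have : (fun x : ℝ => (x : ℂ)).HasTemperateGrowth := by fun_prop
  exact SchwartzMap.smulLeftCLM_apply_apply this f x

theorem momentum_apply (f : SchwartzMap ℝ ℂ) (x : ℝ) :
    momentum f x = -Complex.I * deriv f x := rfl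

theorem position_mul_momentum :
    position * momentum = momentum * position + Complex.I • 1 := by
  ext f x
  have hd : HasDerivAt (position f) (1 * f x + x * deriv f x) x := by
    have h : HasDerivAt (fun y : ℝ => (y : ℂ) * f y) (1 * f x + x * deriv f x) x :=
      (HasDerivAt.ofReal_comp (hasDerivAt_id x)).mul (f.hasDerivAt x)
    exact h.congr_of_eventuallyEq (.of_forall fun y => position_apply f y)
  change position (momentum f) x = momentum (position f) x + Complex.I * f x
  rw [position_apply, momentum_apply, momentum_apply, hd.deriv]
  ring

/-- The annihilation operator `a d/dx + (ν - ib) x`. -/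
noncomputable def lowering (a b ν : ℝ) : Module.End ℂ (SchwartzMap ℝ ℂ) :=
  (ν - Complex.I * b) • position + (Complex.I * a) • momentum

/-- The creation operator `-a d/dx + (ν + ib) x`. -/
noncomputable def raising (a b ν : ℝ) : Module.End ℂ (SchwartzMap ℝ ℂ) :=
  (ν + Complex.I * b) • position - (Complex.I * a) • momentum

theorem lowering_apply (a b ν : ℝ) (f : SchwartzMap ℝ ℂ) (x : ℝ) :
    lowering a b ν f x = (ν - Complex.I * b) * (x * f x) + a * deriv f x := by
  change (ν - Complex.I * b) * position f x + (Complex.I * a) * momentum f x = _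
  rw [position_apply, momentum_apply]
  linear_combination (-a * deriv f x) * Complex.I_mul_I

theorem raising_apply (a b ν : ℝ) (f : SchwartzMap ℝ ℂ) (x : ℝ) :
    raising a b ν f x = (ν + Complex.I * b) * (x * f x) - a * deriv f x := by
  change (ν + Complex.I * b) * position f x - (Complex.I * a) * momentum f x = _
  rw [position_apply, momentum_apply]
  linear_combination (a * deriv f x) * Complex.I_mul_I

theorem lowering_mul_raising (a b ν : ℝ) :
    lowering a b ν * raising a b ν =
      raising a b ν * lowering a b ν + ((2 * a * ν : ℝ) : ℂ) • 1 := by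
  simp only [lowering, raising, mul_add, add_mul, mul_sub, sub_mul, smul_mul_assoc, mul_smul_comm,
    smul_smul, position_mul_momentum, smul_add]
  push_cast
  match_scalars <;> first | ring1 | linear_combination (-2 * a * ν : ℂ) * Complex.I_mul_I

/-- Completing the square: the coefficient of `q̂²` is `|ν - ib|² = ν² + b² = ac`, and `aν` is the
zero-point term left by the commutator. -/
theorem raising_mul_lowering (a b c ν : ℝ) (hν : ν ^ 2 = a * c - b * b) :
    raising a b ν * lowering a b ν + ((a * ν : ℝ) : ℂ) • 1 =
      (a : ℂ) • ((c : ℂ) • (position * position) - (b : ℂ) • (position * momentum)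
        - (b : ℂ) • (momentum * position) + (a : ℂ) • (momentum * momentum)) := by
  have hν' : (ν : ℂ) ^ 2 = a * c - b * b := by exact_mod_cast hν
  have hI := Complex.I_mul_I
  simp only [lowering, raising, mul_add, add_mul, sub_mul, smul_mul_assoc, mul_smul_comm,
    smul_smul, position_mul_momentum, smul_add, smul_sub]
  push_cast
  match_scalars
  · linear_combination hν' - (b : ℂ) * b * hI
  · linear_combination (2 * a * b : ℂ) * hI
  · linear_combination (a * ν + a * b * Complex.I : ℂ) * hI
  · linear_combination (-a * a : ℂ) * hI

/-- The product `conj z * w` as a real bilinear map. -/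
noncomputable def conjMul : ℂ →L[ℝ] ℂ →L[ℝ] ℂ :=
  (ContinuousLinearMap.mul ℝ ℂ).comp (Complex.conjCLE : ℂ →L[ℝ] ℂ)

theorem integrable_conj_mul (f g : SchwartzMap ℝ ℂ) :
    MeasureTheory.Integrable (fun x : ℝ => (starRingEnd ℂ) (f x) * g x) := by
  have := (SchwartzMap.bilinLeftCLM conjMul g.hasTemperateGrowth f).integrable
    (μ := MeasureTheory.volume)
  exact this

theorem integral_conj_mul_raising (a b ν : ℝ) (f g : SchwartzMap ℝ ℂ) :
    ∫ x : ℝ, (starRingEnd ℂ) (f x) * raising a b ν g x =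
      ∫ x : ℝ, (starRingEnd ℂ) (lowering a b ν f x) * g x := by
  have hparts : ∫ x : ℝ, (starRingEnd ℂ) (f x) * deriv g x =
      -∫ x : ℝ, (starRingEnd ℂ) (deriv f x) * g x :=
    SchwartzMap.integral_bilinear_deriv_right_eq_neg_left f g conjMul
  have h1 : MeasureTheory.Integrable (fun x : ℝ => (starRingEnd ℂ) (f x) * deriv g x) :=
    integrable_conj_mul f (SchwartzMap.derivCLM ℂ ℂ g)
  have h2 : MeasureTheory.Integrable (fun x : ℝ => (starRingEnd ℂ) (deriv f x) * g x) :=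
    integrable_conj_mul (SchwartzMap.derivCLM ℂ ℂ f) g
  have h3 : MeasureTheory.Integrable (fun x : ℝ => (starRingEnd ℂ) (f x) * (x * g x)) := by
    simpa only [position_apply] using integrable_conj_mul f (position g)
  have e1 (x : ℝ) : (starRingEnd ℂ) (f x) * raising a b ν g x =
      (ν + Complex.I * b) * ((starRingEnd ℂ) (f x) * (x * g x)) -
        a * ((starRingEnd ℂ) (f x) * deriv g x) := by
    rw [raising_apply]
    ring
  have e2 (x : ℝ) : (starRingEnd ℂ) (lowering a b ν f x) * g x =
      (ν + Complex.I * b) * ((starRingEnd ℂ) (f x) * (x * g x)) +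
        a * ((starRingEnd ℂ) (deriv f x) * g x) := by
    rw [lowering_apply]
    simp only [map_add, map_mul, map_sub, Complex.conj_ofReal, Complex.conj_I]
    ring
  simp_rw [e1, e2]
  rw [MeasureTheory.integral_sub (h3.const_mul _) (h1.const_mul _),
    MeasureTheory.integral_add (h3.const_mul _) (h2.const_mul _),
    MeasureTheory.integral_const_mul, MeasureTheory.integral_const_mul,
    MeasureTheory.integral_const_mul, hparts]
  ring

theorem integral_conj_mul_self (f : SchwartzMap ℝ ℂ) :
    ∫ x : ℝ, (starRingEnd ℂ) (f x) * f x = ((∫ x : ℝ, ‖f x‖ ^ 2 : ℝ) : ℂ) := by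
  rw [← integral_complex_ofReal]
  congr 1 with x
  rw [Complex.conj_mul', Complex.ofReal_pow]

theorem eq_zero_of_integral_norm_sq {f : SchwartzMap ℝ ℂ} (h : ∫ x : ℝ, ‖f x‖ ^ 2 = 0) :
    f = 0 := by
  have hint : MeasureTheory.Integrable (fun x : ℝ => ‖f x‖ ^ 2) := by
    have := (integrable_conj_mul f f).norm
    refine this.congr (.of_forall fun x => ?_)
    simp [sq]
  have hcont : Continuous (fun x : ℝ => ‖f x‖ ^ 2) := by fun_prop
  have h0 := (MeasureTheory.integral_eq_zero_iff_of_nonneg (fun x => sq_nonneg ‖f x‖) hint).mp h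
  have h1 := (hcont.ae_eq_iff_eq MeasureTheory.volume continuous_const).mp h0
  ext x
  exact norm_eq_zero.mp ((pow_eq_zero_iff two_ne_zero).mp (congrFun h1 x))

/-- `raising` is the formal adjoint of `lowering`, so `⟨f, BAf⟩ = ‖Af‖²`. This positivity supplies
both hypotheses of the ladder argument: no negative eigenvalues, and `BAf = 0` forces `Af = 0`. -/
theorem integral_norm_sq_lowering {a b ν μ : ℝ} {f : SchwartzMap ℝ ℂ}
    (h : raising a b ν (lowering a b ν f) = (μ : ℂ) • f) :
    ∫ x : ℝ, ‖lowering a b ν f x‖ ^ 2 = μ * ∫ x : ℝ, ‖f x‖ ^ 2 := by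
  have e := integral_conj_mul_raising a b ν f (lowering a b ν f)
  rw [integral_conj_mul_self, h] at e
  have e2 : ∫ x : ℝ, (starRingEnd ℂ) (f x) * ((μ : ℂ) • f) x =
      (μ : ℂ) * ∫ x : ℝ, (starRingEnd ℂ) (f x) * f x := by
    rw [← MeasureTheory.integral_const_mul]
    congr 1 with x
    change (starRingEnd ℂ) (f x) * ((μ : ℂ) * f x) = _
    ring
  rw [e2, integral_conj_mul_self] at e
  exact_mod_cast e.symm

theorem lowering_eq_zero_of_raising {a b ν : ℝ} {f : SchwartzMap ℝ ℂ}
    (h : raising a b ν (lowering a b ν f) = 0) : lowering a b ν f = 0 := by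
  refine eq_zero_of_integral_norm_sq ?_
  rw [integral_norm_sq_lowering (μ := 0) (by rw [h, Complex.ofReal_zero, zero_smul]), zero_mul]

theorem eq_zero_of_negative_eigenvalue {a b ν μ : ℝ} {f : SchwartzMap ℝ ℂ} (hμ : μ < 0)
    (h : raising a b ν (lowering a b ν f) = (μ : ℂ) • f) : f = 0 := by
  refine eq_zero_of_integral_norm_sq ?_
  have e := integral_norm_sq_lowering h
  have h1 : 0 ≤ ∫ x : ℝ, ‖lowering a b ν f x‖ ^ 2 :=
    MeasureTheory.integral_nonneg fun x => sq_nonneg _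
  have h2 : 0 ≤ ∫ x : ℝ, ‖f x‖ ^ 2 := MeasureTheory.integral_nonneg fun x => sq_nonneg _
  nlinarith

theorem gaussianFun_neg_mul (z : ℂ) (x : ℝ) : gaussianFun (-z) x * gaussianFun z x = 1 := by
  rw [gaussianFun, gaussianFun, ← Complex.exp_add]
  convert Complex.exp_zero using 2
  ring

theorem finrank_ker_lowering {a b ν : ℝ} (ha : 0 < a) (hν : 0 < ν) :
    Module.finrank ℂ (LinearMap.ker (lowering a b ν)) = 1 := by
  have ha' : (a : ℂ) ≠ 0 := by exact_mod_cast ha.ne'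
  set z : ℂ := (ν - Complex.I * b) / a with hzdef
  have hz : 0 < z.re := by
    rw [hzdef, Complex.div_ofReal_re]
    simpa using div_pos hν ha
  have hza : a * z = ν - Complex.I * b := mul_div_cancel₀ _ ha'
  have hmem : gaussian z hz ∈ LinearMap.ker (lowering a b ν) := by
    rw [LinearMap.mem_ker]
    ext x
    rw [lowering_apply]
    change _ * (_ * gaussianFun z x) + _ * deriv (gaussianFun z) x = 0
    rw [(hasDerivAt_gaussianFun z x).deriv, ← hza]
    ring
  refine finrank_eq_one_iff'.mpr ⟨⟨gaussian z hz, hmem⟩, fun h => ?_, fun w => ?_⟩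
  · have h0 := congrArg (fun f : LinearMap.ker (lowering a b ν) => (f : SchwartzMap ℝ ℂ) 0) h
    have h1 := norm_gaussianFun z 0
    change gaussianFun z 0 = 0 at h0
    rw [h0] at h1
    simp at h1
  · obtain ⟨w, hw⟩ := w
    -- Multiplying by the reciprocal Gaussian is the integrating factor of `aψ' + (ν - ib)xψ = 0`.
    have hder (x : ℝ) : HasDerivAt (fun y : ℝ => gaussianFun (-z) y * w y) 0 x := by
      refine ((hasDerivAt_gaussianFun (-z) x).mul (w.hasDerivAt x)).congr_deriv ?_
      have e : lowering a b ν w x = 0 := by rw [LinearMap.mem_ker.mp hw]; rfl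
      rw [lowering_apply, ← hza] at e
      have e' : z * x * w x + deriv w x = 0 := by
        refine (mul_eq_zero.mp (?_ : (a : ℂ) * (z * x * w x + deriv w x) = 0)).resolve_left ha'
        linear_combination e
      linear_combination gaussianFun (-z) x * e'
    have hconst (x : ℝ) := is_const_of_deriv_eq_zero (fun y => (hder y).differentiableAt)
      (fun y => (hder y).deriv) x 0
    refine ⟨gaussianFun (-z) 0 * w 0, ?_⟩
    ext x
    change gaussianFun (-z) 0 * w 0 * gaussianFun z x = w x
    rw [← hconst x]
    linear_combination w x * gaussianFun_neg_mul z x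

/-! ### The von Neumann entropy -/

theorem quadraticHamiltonian_eq {a b c ν : ℝ} (hν : 1 / 2 < ν) (hd : ν ^ 2 = a * c - b * b)
    (ha : 0 < a) :
    quadraticHamiltonian !![a, b; b, c] =
      ((halfBeta ν / (a * ν) : ℝ) : ℂ) •
        (raising a b ν * lowering a b ν + ((a * ν : ℝ) : ℂ) • 1) := by
  have ha' : (a : ℂ) ≠ 0 := by exact_mod_cast ha.ne'
  have hν' : (ν : ℂ) ≠ 0 := by exact_mod_cast (show ν ≠ 0 by linarith)
  rw [raising_mul_lowering a b c ν hd, quadraticHamiltonian,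
    hamiltonianMatrix_eq (by rw [← hd]; nlinarith), ← hd, profile_sq hν]
  simp only [Fin.sum_univ_two, toC, quadrature, Matrix.map_apply, Matrix.smul_apply,
    Matrix.of_apply, Matrix.cons_val', Matrix.cons_val_zero, Matrix.cons_val_one,
    Matrix.cons_val_fin_one, smul_eq_mul]
  push_cast
  match_scalars <;> field_simp

theorem eigenspace_quadraticHamiltonian {a b c ν : ℝ} (hν : 1 / 2 < ν)
    (hd : ν ^ 2 = a * c - b * b) (ha : 0 < a) (μ : ℝ) :
    Module.End.eigenspace (quadraticHamiltonian !![a, b; b, c])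
        ((halfBeta ν / (a * ν) * (μ + a * ν) : ℝ) : ℂ) =
      Module.End.eigenspace (raising a b ν * lowering a b ν) (μ : ℂ) := by
  have hν0 : 0 < ν := by linarith
  have hs : ((halfBeta ν / (a * ν) : ℝ) : ℂ) ≠ 0 := by
    have := halfBeta_pos hν
    exact_mod_cast (show halfBeta ν / (a * ν) ≠ 0 by positivity)
  ext ψ
  rw [quadraticHamiltonian_eq hν hd ha, Module.End.mem_eigenspace_iff,
    Module.End.mem_eigenspace_iff, Complex.ofReal_mul (halfBeta ν / (a * ν)), mul_smul,
    LinearMap.smul_apply, smul_right_inj hs, LinearMap.add_apply, Complex.ofReal_add, add_smul,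
    LinearMap.smul_apply, Module.End.one_apply, add_left_inj]

theorem finrank_eigenspace_quadraticHamiltonian {a b c ν : ℝ} (hν : 1 / 2 < ν)
    (hd : ν ^ 2 = a * c - b * b) (ha : 0 < a) (n : ℕ) :
    Module.finrank ℂ (Module.End.eigenspace (quadraticHamiltonian !![a, b; b, c])
        ((halfBeta ν * (2 * n + 1) : ℝ) : ℂ)) = 1 := by
  have hν0 : 0 < ν := by linarith
  have e : halfBeta ν * (2 * n + 1) =
      halfBeta ν / (a * ν) * (n * (2 * a * ν) + a * ν) := by
    field_simp
  rw [e, eigenspace_quadraticHamiltonian hν hd ha]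
  exact finrank_eigenspace_ladder (by positivity) (lowering_mul_raising a b ν)
    (fun _ => lowering_eq_zero_of_raising) (finrank_ker_lowering ha hν0) n

theorem finrank_eigenspace_quadraticHamiltonian_eq_zero {a b c ν : ℝ} (hν : 1 / 2 < ν)
    (hd : ν ^ 2 = a * c - b * b) (ha : 0 < a) {E : ℝ}
    (hE : ∀ n : ℕ, halfBeta ν * (2 * n + 1) ≠ E) :
    Module.finrank ℂ (Module.End.eigenspace (quadraticHamiltonian !![a, b; b, c])
        (E : ℂ)) = 0 := by
  have hν0 : 0 < ν := by linarith
  have ht := halfBeta_pos hν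
  have e : E = halfBeta ν / (a * ν) * ((a * ν * E / halfBeta ν - a * ν) + a * ν) := by
    field_simp
    ring
  rw [e, eigenspace_quadraticHamiltonian hν hd ha,
    eigenspace_ladder_eq_bot (lowering_mul_raising a b ν) (by positivity)
      (fun μ ψ => eq_zero_of_negative_eigenvalue), finrank_bot]
  intro n hn
  refine hE n ?_
  rw [sub_eq_iff_eq_add, div_eq_iff ht.ne'] at hn
  have h2 : a * ν * (halfBeta ν * (2 * n + 1)) = a * ν * E := by rw [hn]; ring
  exact mul_left_cancel₀ (by positivity) h2

/-- The entropy in terms of half the inverse temperature. -/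
noncomputable def entropyProfile (t : ℝ) : ℝ :=
  t * (Real.cosh t / Real.sinh t) - Real.log (2 * Real.sinh t)

theorem strictAntiOn_entropyProfile : StrictAntiOn entropyProfile (Set.Ioi 0) := by
  have hder (t : ℝ) (ht : 0 < t) :
      HasDerivAt entropyProfile (-(t / Real.sinh t ^ 2)) t := by
    have hs := Real.sinh_pos_iff.mpr ht
    refine (((hasDerivAt_id t).mul ((Real.hasDerivAt_cosh t).div (Real.hasDerivAt_sinh t)
      hs.ne')).sub (((Real.hasDerivAt_sinh t).const_mul 2).log (by positivity))).congr_deriv ?_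
    have e := Real.cosh_sq_sub_sinh_sq t
    simp only [Pi.div_apply, id]
    field_simp
    linear_combination -t * e
  refine strictAntiOn_of_deriv_neg (convex_Ioi 0)
    (fun x hx => (hder x hx).continuousAt.continuousWithinAt) fun t ht => ?_
  rw [interior_Ioi] at ht
  have ht : 0 < t := ht
  have hs := Real.sinh_pos_iff.mpr ht
  rw [(hder t ht).deriv, neg_lt_zero]
  positivity

/-- With `w = exp(-t)` the weights are the geometric law `(1 - w²) w^(2n)`, whose logarithm is
affine in `n`; only `∑ w^(2n)` and `∑ n w^(2n)` are needed. -/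
theorem hasSum_negMulLog_thermal {t : ℝ} (ht : 0 < t) :
    HasSum (fun n : ℕ => Real.negMulLog (2 * Real.sinh t * Real.exp (-(t * (2 * n + 1)))))
      (entropyProfile t) := by
  have hs := Real.sinh_pos_iff.mpr ht
  set w := Real.exp (-t) with hw
  have hw0 : 0 < w := Real.exp_pos _
  have hw1 : w < 1 := by rw [hw, Real.exp_lt_one_iff]; linarith
  have hexp : Real.exp t = w⁻¹ := by rw [hw, Real.exp_neg, inv_inv]
  have hw2 : w ^ 2 < 1 := by nlinarith
  have hn : ‖w ^ 2‖ < 1 := by rwa [Real.norm_of_nonneg (by positivity)]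
  have h1 := hasSum_geometric_of_lt_one (by positivity) hw2
  have h2 := hasSum_coe_mul_geometric_of_norm_lt_one hn
  have hterm (n : ℕ) : Real.exp (-(t * (2 * n + 1))) = w * (w ^ 2) ^ n := by
    rw [hw, ← Real.exp_nat_mul, ← Real.exp_nat_mul, ← Real.exp_add]
    congr 1
    push_cast
    ring
  have hlog (n : ℕ) : Real.log (2 * Real.sinh t * Real.exp (-(t * (2 * n + 1)))) =
      Real.log (2 * Real.sinh t) - t * (2 * n + 1) := by
    rw [Real.log_mul (by positivity) (Real.exp_ne_zero _), Real.log_exp]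
    ring
  have hsum := (h1.mul_left (-(2 * Real.sinh t * w) * (Real.log (2 * Real.sinh t) - t))).add
    (h2.mul_left (2 * Real.sinh t * w * (2 * t)))
  have h3 : 2 * Real.sinh t * w = 1 - w ^ 2 := by
    rw [Real.sinh_eq, hexp, ← hw]
    field_simp
  have h4 : 2 * Real.cosh t * w = 1 + w ^ 2 := by
    rw [Real.cosh_eq, hexp, ← hw]
    field_simp
  have h5 : 1 - w ^ 2 ≠ 0 := by linarith
  have hval : -(2 * Real.sinh t * w) * (Real.log (2 * Real.sinh t) - t) * (1 - w ^ 2)⁻¹ +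
      2 * Real.sinh t * w * (2 * t) * (w ^ 2 / (1 - w ^ 2) ^ 2) = entropyProfile t := by
    have h6 : Real.cosh t / Real.sinh t = (1 + w ^ 2) / (1 - w ^ 2) := by
      rw [← h3, ← h4]
      field_simp
    rw [entropyProfile, h6, h3]
    generalize Real.log (2 * Real.sinh t) = l
    field_simp
    ring
  rw [hval] at hsum
  refine hsum.congr_fun fun n => ?_
  rw [Real.negMulLog, hlog, hterm]
  ring

theorem det_uncertaintyMatrix (a b c : ℝ) :
    (uncertaintyMatrix !![a, b; b, c]).det = ((a * c - b * b - 1 / 4 : ℝ) : ℂ) := by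
  rw [Matrix.det_fin_two]
  simp [uncertaintyMatrix, toC, Omega]
  linear_combination (1 / 4 : ℂ) * Complex.I_mul_I

theorem stateEigenvalue_eq {a b c ν : ℝ} (hν : 1 / 2 < ν) (hd : ν ^ 2 = a * c - b * b) (E : ℝ) :
    stateEigenvalue !![a, b; b, c] E = 2 * Real.sinh (halfBeta ν) * Real.exp (-E) := by
  have hs : 0 < Real.sinh (halfBeta ν) := Real.sinh_pos_iff.mpr (halfBeta_pos hν)
  have hth := tanh_halfBeta hν
  rw [Real.tanh_eq_sinh_div_cosh] at hth
  have e := Real.cosh_sq_sub_sinh_sq (halfBeta ν)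
  have hc : 0 < Real.cosh (halfBeta ν) := Real.cosh_pos _
  rw [stateEigenvalue, det_uncertaintyMatrix, Complex.ofReal_re, ← hd]
  congr 1
  have hν0 : ν ≠ 0 := by linarith
  have h1 : ν ^ 2 - 1 / 4 ≠ 0 := by nlinarith
  have h2 : 1 / (ν ^ 2 - 1 / 4) = (2 * Real.sinh (halfBeta ν)) ^ 2 := by
    rw [div_eq_iff hc.ne'] at hth
    rw [div_eq_iff h1, hth]
    have h3 : Real.cosh (halfBeta ν) ^ 2 * (1 - (1 / (2 * ν)) ^ 2) = 1 := by
      rw [hth] at e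
      linear_combination e
    field_simp at h3 ⊢
    linear_combination -h3
  rw [h2, Real.sqrt_sq (by positivity)]

theorem entropy_eq {a b c ν : ℝ} (hν : 1 / 2 < ν) (hd : ν ^ 2 = a * c - b * b) (ha : 0 < a) :
    entropy !![a, b; b, c] = entropyProfile (halfBeta ν) := by
  have ht := halfBeta_pos hν
  have hinj : Function.Injective fun n : ℕ => halfBeta ν * (2 * n + 1) := fun m n h => by
    have := mul_left_cancel₀ ht.ne' h
    have h' : (m : ℝ) = n := by linarith
    exact_mod_cast h'
  -- The sum over all real energies is supported on the oscillator levels, since every other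
  -- eigenspace has dimension zero.
  rw [entropy, ← hinj.tsum_eq]
  · rw [← (hasSum_negMulLog_thermal ht).tsum_eq]
    refine tsum_congr fun n => ?_
    rw [finrank_eigenspace_quadraticHamiltonian hν hd ha, stateEigenvalue_eq hν hd, Nat.cast_one,
      one_mul]
  · intro E hE
    by_contra hn
    refine hE ?_
    simp only
    rw [finrank_eigenspace_quadraticHamiltonian_eq_zero hν hd ha
      fun n h => hn ⟨n, h⟩, Nat.cast_zero, zero_mul]

/-! ### Covariance matrices and symplectic eigenvalues -/

open scoped ComplexOrder in
theorem IsFaithfulCov.exists_entries {V : Matrix (Fin 2) (Fin 2) ℝ} (hV : IsFaithfulCov V) :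
    ∃ a b c ν : ℝ, V = !![a, b; b, c] ∧ 0 < a ∧ 1 / 2 < ν ∧ ν ^ 2 = a * c - b * b := by
  obtain ⟨hsymm, hpos⟩ := hV
  have h01 : V 1 0 = V 0 1 := hsymm.apply 0 1
  have hVe : V = !![V 0 0, V 0 1; V 0 1, V 1 1] := by
    ext i j
    fin_cases i <;> fin_cases j <;> simp [h01]
  have hdet := hpos.det_pos
  have hdiag := hpos.diag_pos (i := 0)
  rw [hVe, det_uncertaintyMatrix, Complex.zero_lt_real] at hdet
  have ha : 0 < V 0 0 := by
    have e : uncertaintyMatrix V 0 0 = (V 0 0 : ℂ) := by simp [uncertaintyMatrix, toC, Omega]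
    rwa [e, Complex.zero_lt_real] at hdiag
  refine ⟨V 0 0, V 0 1, V 1 1, √(V 0 0 * V 1 1 - V 0 1 * V 0 1), hVe, ha,
    half_lt_sqrt (by linarith), Real.sq_sqrt (by linarith)⟩

open scoped ComplexOrder in
theorem isFaithfulCov_smul_one {ν : ℝ} (hν : 1 / 2 < ν) :
    IsFaithfulCov (ν • (1 : Matrix (Fin 2) (Fin 2) ℝ)) := by
  refine ⟨by rw [Matrix.IsSymm, Matrix.transpose_smul, Matrix.transpose_one],
    Matrix.PosDef.of_dotProduct_mulVec_pos ?_ fun x hx => ?_⟩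
  · ext i j
    fin_cases i <;> fin_cases j <;>
      simp [uncertaintyMatrix, toC, Omega, Matrix.conjTranspose_apply, neg_div]
  -- Positivity is certified by a sum of squares: the cross terms of `½|x₀ + i x₁|²` are exactly the
  -- contribution of `iΩ/2`.
  · have e : star x ⬝ᵥ (uncertaintyMatrix (ν • (1 : Matrix (Fin 2) (Fin 2) ℝ))).mulVec x =
        (((ν - 1 / 2) * (‖x 0‖ ^ 2 + ‖x 1‖ ^ 2) +
          1 / 2 * ‖x 0 + Complex.I * x 1‖ ^ 2 : ℝ) : ℂ) := by
      push_cast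
      simp only [← Complex.conj_mul', map_add, map_mul, Complex.conj_I]
      simp [uncertaintyMatrix, toC, Omega, Matrix.mulVec, dotProduct, Fin.sum_univ_two]
      linear_combination (1 / 2 * (starRingEnd ℂ) (x 1) * x 1) * Complex.I_mul_I
    rw [e, Complex.zero_lt_real]
    have h0 : x 0 ≠ 0 ∨ x 1 ≠ 0 := by
      by_contra! h
      exact hx (by ext i; fin_cases i <;> simp [h.1, h.2])
    have h1 : 0 < ‖x 0‖ ^ 2 + ‖x 1‖ ^ 2 := by
      rcases h0 with h | h
      · have := norm_pos_iff.mpr h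
        positivity
      · have := norm_pos_iff.mpr h
        positivity
    have h2 : 0 < ν - 1 / 2 := by linarith
    positivity

theorem IsSymplecticEigenvalue.sq_eq_det {V : Matrix (Fin 2) (Fin 2) ℝ} {ν : ℝ}
    (h : IsSymplecticEigenvalue V ν) : ν ^ 2 = V.det := by
  obtain ⟨-, S, hS, rfl⟩ := h
  have hdet : S.det * S.det = 1 := by
    have := congrArg Matrix.det hS
    rw [Matrix.det_mul, Matrix.det_mul, Matrix.det_transpose] at this
    have hO : Omega.det = 1 := by simp [Omega, Matrix.det_fin_two]
    rw [hO] at this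
    linarith
  rw [Matrix.det_mul, Matrix.det_mul, Matrix.det_transpose, Matrix.det_smul, Matrix.det_one,
    Fintype.card_fin]
  linear_combination -ν ^ 2 * hdet

theorem isSymplecticEigenvalue_of_sq_eq {a b c ν : ℝ} (ha : 0 < a) (hν : 0 < ν)
    (hd : ν ^ 2 = a * c - b * b) : IsSymplecticEigenvalue !![a, b; b, c] ν := by
  have hsa : √a ≠ 0 := (Real.sqrt_pos.mpr ha).ne'
  have hsν : √ν ≠ 0 := (Real.sqrt_pos.mpr hν).ne'
  have ea : √a ^ 2 = a := Real.sq_sqrt ha.le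
  have eν : √ν ^ 2 = ν := Real.sq_sqrt hν.le
  -- The witness is the lower triangular Cholesky factor of the matrix divided by `√ν`; it has
  -- determinant one, which for size two means symplectic.
  refine ⟨hν, !![√a / √ν, 0; b / (√a * √ν), √ν / √a], ?_, ?_⟩
  · ext i j
    fin_cases i <;> fin_cases j <;>
      simp [Omega, Matrix.mul_apply, Fin.sum_univ_two]
    · field_simp
    · field_simp
    · ring
  · have h4 : √ν ^ 4 = a * c - b ^ 2 := by
      rw [show √ν ^ 4 = (√ν ^ 2) ^ 2 by ring, eν, hd]
      ring
    ext i j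
    fin_cases i <;> fin_cases j <;>
      simp [Matrix.mul_apply, Fin.sum_univ_two] <;> field_simp
    · rw [ea, eν]; ring
    · rw [eν]
    · rw [eν]
    · rw [h4, ea, eν]; ring

theorem coordDet_coord_of (a b c : ℝ) : coordDet (coord !![a, b; b, c]) = a * c - b * b := by
  simp [coordDet, coord]

end KMB

theorem corollary1 :
    -- every faithful single-mode covariance matrix has a unique symplectic eigenvalue
    (∀ V : Matrix (Fin 2) (Fin 2) ℝ, KMB.IsFaithfulCov V →
      ∃! ν : ℝ, KMB.IsSymplecticEigenvalue V ν) ∧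
    -- it lies in (1/2, ∞), and the scalar curvature depends on the matrix only through it
    (∀ (V : Matrix (Fin 2) (Fin 2) ℝ) (ν : ℝ), KMB.IsFaithfulCov V →
      KMB.IsSymplecticEigenvalue V ν →
        1 / 2 < ν ∧ KMB.scal V = KMB.scal (ν • (1 : Matrix (Fin 2) (Fin 2) ℝ))) ∧
    -- every number in (1/2, ∞) occurs as a symplectic eigenvalue
    (∀ ν : ℝ, 1 / 2 < ν →
      KMB.IsFaithfulCov (ν • (1 : Matrix (Fin 2) (Fin 2) ℝ)) ∧
        KMB.IsSymplecticEigenvalue (ν • (1 : Matrix (Fin 2) (Fin 2) ℝ)) ν) ∧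
    -- the scalar curvature is strictly increasing in the symplectic eigenvalue
    StrictMonoOn (fun ν : ℝ => KMB.scal (ν • (1 : Matrix (Fin 2) (Fin 2) ℝ)))
      (Set.Ioi (1 / 2)) ∧
    -- the curvature orders the states exactly as the von Neumann entropy does
    (∀ V V' : Matrix (Fin 2) (Fin 2) ℝ, KMB.IsFaithfulCov V → KMB.IsFaithfulCov V' →
      (KMB.scal V' > KMB.scal V ↔ KMB.entropy V' > KMB.entropy V)) ∧
    -- the two limits
    Filter.Tendsto (fun ν : ℝ => KMB.scal (ν • (1 : Matrix (Fin 2) (Fin 2) ℝ)))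
      Filter.atTop (nhds (-2)) ∧
    Filter.Tendsto (fun ν : ℝ => KMB.scal (ν • (1 : Matrix (Fin 2) (Fin 2) ℝ)))
      (nhdsWithin (1 / 2) (Set.Ioi (1 / 2))) Filter.atBot := by
  have huniq {a b c ν ν' : ℝ} (hν : 1 / 2 < ν) (hd : ν ^ 2 = a * c - b * b)
      (h : KMB.IsSymplecticEigenvalue !![a, b; b, c] ν') : ν' = ν := by
    have h1 := h.sq_eq_det
    rw [Matrix.det_fin_two_of, ← hd] at h1
    exact (pow_left_inj₀ h.1.le (by linarith) two_ne_zero).mp h1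
  refine ⟨fun V hV => ?_, fun V ν' hV h => ?_, fun ν hν => ⟨KMB.isFaithfulCov_smul_one hν, ?_⟩,
    KMB.strictMonoOn_scal, fun V V' hV hV' => ?_, KMB.tendsto_scal_atTop, KMB.tendsto_scal_half⟩
  · obtain ⟨a, b, c, ν, rfl, ha, hν, hd⟩ := hV.exists_entries
    exact ⟨ν, KMB.isSymplecticEigenvalue_of_sq_eq ha (by linarith) hd, fun _ => huniq hν hd⟩
  · obtain ⟨a, b, c, ν, rfl, ha, hν, hd⟩ := hV.exists_entries
    obtain rfl := huniq hν hd h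
    refine ⟨hν, ?_⟩
    rw [KMB.scal_smul_one hν, KMB.scal_eq_of_coordDet hν]
    rw [KMB.coordDet_coord_of, hd]
  · exact ⟨by linarith, 1, by simp, by simp⟩
  · obtain ⟨a, b, c, ν, rfl, ha, hν, hd⟩ := hV.exists_entries
    obtain ⟨a', b', c', ν', rfl, ha', hν', hd'⟩ := hV'.exists_entries
    rw [KMB.scal_eq_of_coordDet hν ((KMB.coordDet_coord_of a b c).trans hd.symm),
      KMB.scal_eq_of_coordDet hν' ((KMB.coordDet_coord_of a' b' c').trans hd'.symm),
      KMB.entropy_eq hν hd ha, KMB.entropy_eq hν' hd' ha', gt_iff_lt, gt_iff_lt,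
      sub_lt_sub_iff_left]
    have ht := KMB.halfBeta_pos hν
    have ht' := KMB.halfBeta_pos hν'
    -- Both inequalities reduce to the same comparison of half inverse temperatures, the one of `V'`
    -- being smaller.
    rw [KMB.strictMonoOn_curvatureProfile.lt_iff_lt ht' ht,
      KMB.strictAntiOn_entropyProfile.lt_iff_gt ht ht']
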